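/- Let $\mathfrak g$ be the Kac–Moody Lie algebra over $\mathbb C$ of a generalized Cartan matrix, with Cartan subalgebra $\mathfrak h$, simple roots $\alpha_i$, simple coroots $\alpha_i^\vee$, root spaces $\mathfrak g_\beta$, set of positive roots $\Delta^+$, and $Q_+=\bigoplus_i\mathbb Z_{\ge 0}\alpha_i$. For $\alpha,\beta\in\Delta^+$ write $\alpha\le\beta$ if $\beta-\alpha\in Q_+$. Put $\mathfrak g'=[\mathfrak g,\mathfrak g]$, $\mathfrak h'=\mathfrak g'\cap\mathfrak h$, $N^+=\bigoplus_{\beta\in\Delta^+}\mathfrak g_\beta$, and choose a subspace $\mathfrak h''$ with $\mathfrak h=\mathfrak h'\oplus\mathfrak h''$. Let $A$ be a finitely generated commutative associative unital $\mathbb C$-algebra, and let $\tilde{\mathfrak g}=\mathfrak g'\otimes A\oplus\mathfrak h''$ be the Lie algebra with brackets $[X\otimes a,Y\otimes b]=[X,Y]\otimes ab$, $[h,X\otimes a]=[h,X]\otimes a$, $[h,k]=0$ for $X,Y\in\mathfrak g'$, $a,b\in A$, $h,k\in\mathfrak h''$. Put $\tilde{\mathfrak h}=\mathfrak h'\otimes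 A\oplus\mathfrak h''$, in which $\mathfrak h$ is embedded as $\mathfrak h'\otimes 1\oplus\mathfrak h''$. Let $I$ be an ideal of $A$ of finite codimension, and let $\{I_\alpha\}_{\alpha\in\Delta^+}$ be ideals of $A$ of finite codimension with $I_\alpha\subseteq I$, such that $I_\beta\subseteq I_\alpha$ whenever $\alpha\le\beta$, and $I_\alpha I_\beta\subseteq I_{\alpha+\beta}$ whenever $\alpha+\beta\in\Delta^+$. Let $\psi:\tilde{\mathfrak h}\to\mathbb C$ be a linear map with $\psi|_{\mathfrak h'\otimes I}=0$ and $\psi|_{\mathfrak h}=\lambda$, where $\lambda\in\mathfrak h^*$ is dominant integral, i.e. $\lambda(\alpha_i^\vee)\in\mathbb Z_{\ge0}$ for all $i$. Let $M(\psi)=U(\tilde{\mathfrak g})\otimes_{U(N^+\otimes A\oplus\tilde{\mathfrak h})}\mathbb C$ be the Verma module of highest weight $\psi$ ($N^+\otimes A$ acts on $\mathbb C$ by $0$ and $\tilde{\mathfrak h}$ acts by $\psi$), with canonical generator $v$. Let $N\subseteq M(\psi)$ be the $\tilde{\mathfrak g}$-submodule generated by all $(X\otimes a)v$ with $\beta\in\Delta^+$,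 $X\in\mathfrak g_{-\beta}$, $a\in I_\beta$, and put $M(\psi,\{I_\alpha\})=M(\psi)/N$. Then $N$ is a proper submodule of $M(\psi)$. The module $M(\psi,\{I_\alpha\})$ is a highest weight module of highest weight $\psi$ whose highest weight vector $\bar v$, the image of $v$, is nonzero, generates the module, is killed by $N^+\otimes A$, satisfies $h\bar v=\psi(h)\bar v$ for all $h\in\tilde{\mathfrak h}$, and is killed by $X\otimes a$ for all $\beta\in\Delta^+$, $X\in\mathfrak g_{-\beta}$, $a\in I_\beta$. Moreover, $M(\psi,\{I_\alpha\})$ is the sum of its weight spaces with respect to $\mathfrak h$, and each of these weight spaces is finite-dimensional. -/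

import Mathlib

open scoped TensorProduct

noncomputable section

namespace KacMoody

universe u v w

/-- A generalized Cartan matrix. -/
structure IsGCM {ι : Type u} (C : Matrix ι ι ℤ) : Prop where
  diag : ∀ i, C i i = 2
  offDiag : ∀ i j, i ≠ j → C i j ≤ 0
  zero_symm : ∀ i j, C i j = 0 → C j i = 0

/-- A (minimal) realization `(𝔥, {α_i}, {α_i^∨})` of the matrix `C` over `ℂ`. -/
structure Realization {ι : Type u} [Fintype ι] (C : Matrix ι ι ℤ)
    (𝔥 : Type v) [AddCommGroup 𝔥] [Module ℂ 𝔥] where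
  /-- the simple roots `α_i` -/
  root : ι → Module.Dual ℂ 𝔥
  /-- the simple coroots `α_i^∨` -/
  coroot : ι → 𝔥
  finiteDimensional : FiniteDimensional ℂ 𝔥
  linearIndependent_root : LinearIndependent ℂ root
  linearIndependent_coroot : LinearIndependent ℂ coroot
  root_coroot : ∀ i j, root j (coroot i) = (C i j : ℂ)
  finrank_add_rank :
    Module.finrank ℂ 𝔥 + (C.map (Int.cast : ℤ → ℂ)).rank = 2 * Fintype.card ι

/-- The generators: the elements of `𝔥` and the Chevalley generators `e_i`, `f_i`. -/
inductive Gen (ι : Type u) (𝔥 : Type v) : Type (max u v)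
  | H : 𝔥 → Gen ι 𝔥
  | E : ι → Gen ι 𝔥
  | F : ι → Gen ι 𝔥

/-- The generator of the free Lie algebra given by `x ∈ 𝔥`. -/
def gH (ι : Type u) {𝔥 : Type v} (x : 𝔥) : FreeLieAlgebra ℂ (Gen ι 𝔥) :=
  FreeLieAlgebra.of ℂ (Gen.H x)

/-- The generator `e_i` of the free Lie algebra. -/
def gE {ι : Type u} (𝔥 : Type v) (i : ι) : FreeLieAlgebra ℂ (Gen ι 𝔥) :=
  FreeLieAlgebra.of ℂ (Gen.E i)

/-- The generator `f_i` of the free Lie algebra. -/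
def gF {ι : Type u} (𝔥 : Type v) (i : ι) : FreeLieAlgebra ℂ (Gen ι 𝔥) :=
  FreeLieAlgebra.of ℂ (Gen.F i)

namespace Realization

variable {ι : Type u} [Fintype ι] {C : Matrix ι ι ℤ}
  {𝔥 : Type v} [AddCommGroup 𝔥] [Module ℂ 𝔥] (R : Realization C 𝔥)

/-! ### The Kac–Moody algebra -/

/-- The defining relations of the auxiliary algebra: linearity of `𝔥`, `[h, h'] = 0`,
`[h, e_i] = α_i(h) e_i`, `[h, f_i] = -α_i(h) f_i`, `[e_i, f_j] = δ_{ij} α_i^∨`. -/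
inductive Rel : FreeLieAlgebra ℂ (Gen ι 𝔥) → FreeLieAlgebra ℂ (Gen ι 𝔥) → Prop
  | add (x y : 𝔥) : Rel (gH ι (x + y)) (gH ι x + gH ι y)
  | smul (c : ℂ) (x : 𝔥) : Rel (gH ι (c • x)) (c • gH ι x)
  | hh (x y : 𝔥) : Rel ⁅gH ι x, gH ι y⁆ 0
  | he (x : 𝔥) (i : ι) : Rel ⁅gH ι x, gE 𝔥 i⁆ (R.root i x • gE 𝔥 i)
  | hf (x : 𝔥) (i : ι) : Rel ⁅gH ι x, gF 𝔥 i⁆ (-(R.root i x • gF 𝔥 i))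
  | ef (i : ι) : Rel ⁅gE 𝔥 i, gF 𝔥 i⁆ (gH ι (R.coroot i))
  | ef_ne (i j : ι) (hij : i ≠ j) : Rel ⁅gE 𝔥 i, gF 𝔥 j⁆ 0

/-- The ideal generated by the defining relations. -/
def relIdeal : LieIdeal ℂ (FreeLieAlgebra ℂ (Gen ι 𝔥)) :=
  LieSubmodule.lieSpan ℂ _ {z | ∃ x y, R.Rel x y ∧ z = x - y}

/-- The auxiliary Lie algebra: generators `𝔥, e_i, f_i` modulo the defining relations. -/
abbrev AuxAlg : Type (max u v) := FreeLieAlgebra ℂ (Gen ι 𝔥) ⧸ R.relIdeal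

/-- The image of `x ∈ 𝔥` in the auxiliary Lie algebra. -/
def auxH (x : 𝔥) : R.AuxAlg := LieSubmodule.Quotient.mk (gH ι x)

/-- The sum of all ideals of the auxiliary algebra that intersect `𝔥` trivially
(it is the largest such ideal). -/
def radical : LieIdeal ℂ R.AuxAlg :=
  sSup {J | ∀ x : 𝔥, R.auxH x ∈ J → R.auxH x = 0}

/-- The Kac–Moody algebra `𝔤 = 𝔤(C)`. -/
def Alg : Type (max u v) := R.AuxAlg ⧸ R.radical

instance : LieRing R.Alg := inferInstanceAs (LieRing (R.AuxAlg ⧸ R.radical))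

instance : LieAlgebra ℂ R.Alg := inferInstanceAs (LieAlgebra ℂ (R.AuxAlg ⧸ R.radical))

/-- The quotient map from the free Lie algebra on the generators onto `𝔤`. -/
def proj (x : FreeLieAlgebra ℂ (Gen ι 𝔥)) : R.Alg :=
  (LieSubmodule.Quotient.mk (LieSubmodule.Quotient.mk x : R.AuxAlg) : R.AuxAlg ⧸ R.radical)

theorem proj_add (x y) : R.proj (x + y) = R.proj x + R.proj y := rfl

theorem proj_smul (c : ℂ) (x) : R.proj (c • x) = c • R.proj x := rfl

theorem proj_lie (x y) : R.proj ⁅x, y⁆ = ⁅R.proj x, R.proj y⁆ := rfl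

theorem proj_zero : R.proj 0 = 0 := rfl

theorem proj_eq_of_rel {x y} (h : R.Rel x y) : R.proj x = R.proj y := by
  unfold proj
  congr 1
  refine (Submodule.Quotient.eq _).2 ?_
  exact LieSubmodule.subset_lieSpan ⟨x, y, h, rfl⟩

/-- The canonical (injective) map `𝔥 → 𝔤`. -/
def ofH : 𝔥 →ₗ[ℂ] R.Alg where
  toFun x := R.proj (gH ι x)
  map_add' x y := by rw [← proj_add]; exact R.proj_eq_of_rel (.add x y)
  map_smul' c x := by
    rw [RingHom.id_apply, ← proj_smul]; exact R.proj_eq_of_rel (.smul c x)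

theorem ofH_lie_ofH (x y : 𝔥) : ⁅R.ofH x, R.ofH y⁆ = 0 := by
  change ⁅R.proj _, R.proj _⁆ = 0
  rw [← proj_lie, ← proj_zero]; exact R.proj_eq_of_rel (.hh x y)

/-- The derived algebra `𝔤' = [𝔤, 𝔤]`. -/
abbrev derived : LieIdeal ℂ R.Alg := ⁅(⊤ : LieIdeal ℂ R.Alg), (⊤ : LieIdeal ℂ R.Alg)⁆

/-- `𝔥' = 𝔤' ∩ 𝔥`. -/
def cartanDerived : Submodule ℂ 𝔥 := R.derived.toSubmodule.comap R.ofH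

/-! ### Roots -/

/-- `𝔤_β = {x ∈ 𝔤 | [h, x] = β(h) x for all h ∈ 𝔥}`. -/
def rootSpace (β : Module.Dual ℂ 𝔥) : Submodule ℂ R.Alg where
  carrier := {x | ∀ h : 𝔥, ⁅R.ofH h, x⁆ = β h • x}
  zero_mem' h := by simp
  add_mem' hx hy h := by rw [lie_add, hx h, hy h, smul_add]
  smul_mem' c x hx h := by rw [lie_smul, hx h, smul_comm]

/-- `Q_+ = ⊕ ℤ_{≥ 0} α_i`. -/
def posCone : AddSubmonoid (Module.Dual ℂ 𝔥) := AddSubmonoid.closure (Set.range R.root)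

/-- The set `Δ^+` of positive roots. -/
def posRoots : Set (Module.Dual ℂ 𝔥) :=
  {β | β ∈ R.posCone ∧ β ≠ 0 ∧ R.rootSpace β ≠ ⊥}

/-! ### The Lie algebra `𝔤' ⊗ A ⊕ 𝔥''` -/

/-- The derivation `ad h` of `𝔤'`, for `h ∈ 𝔥`. -/
def adH (h : 𝔥) : LieDerivation ℂ R.derived R.derived where
  toFun x := ⟨⁅R.ofH h, (x : R.Alg)⁆, R.derived.lie_mem x.2⟩
  map_add' x y := by ext; simp
  map_smul' c x := by ext; simp
  leibniz' x y := by
    ext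
    change ⁅R.ofH h, ⁅(x : R.Alg), (y : R.Alg)⁆⁆ =
      ⁅(x : R.Alg), ⁅R.ofH h, (y : R.Alg)⁆⁆ - ⁅(y : R.Alg), ⁅R.ofH h, (x : R.Alg)⁆⁆
    rw [leibniz_lie, ← lie_skew (y : R.Alg)]
    abel

variable (A : Type w) [CommRing A] [Algebra ℂ A] (𝔥'' : Submodule ℂ 𝔥)

/-- The action `h · (a ⊗ X) = a ⊗ [h, X]` of `h ∈ 𝔥` on `𝔤' ⊗ A`. -/
def actH (h : 𝔥) : LieDerivation ℂ (A ⊗[ℂ] R.derived) (A ⊗[ℂ] R.derived) :=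
  Lie.Derivation.ofLieDerivation A (R.adH h)

theorem actH_tmul (h : 𝔥) (a : A) (x : R.derived) :
    R.actH A h (a ⊗ₜ x) = a ⊗ₜ R.adH h x := rfl

theorem actH_add (h k : 𝔥) (t : A ⊗[ℂ] R.derived) :
    R.actH A (h + k) t = R.actH A h t + R.actH A k t := by
  induction t with
  | zero => simp
  | add x y hx hy => rw [map_add, hx, hy, map_add, map_add]; abel
  | tmul a x =>
    simp only [actH_tmul, ← TensorProduct.tmul_add]
    congr 1; ext; simp [adH]

theorem actH_smul (c : ℂ) (h : 𝔥) (t : A ⊗[ℂ] R.derived) :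
    R.actH A (c • h) t = c • R.actH A h t := by
  induction t with
  | zero => simp
  | add x y hx hy => rw [map_add, hx, hy, map_add, smul_add]
  | tmul a x =>
    simp only [actH_tmul, ← TensorProduct.tmul_smul]
    congr 1; ext; simp [adH]

theorem actH_comm (h k : 𝔥) (t : A ⊗[ℂ] R.derived) :
    R.actH A h (R.actH A k t) = R.actH A k (R.actH A h t) := by
  induction t with
  | zero => simp
  | add x y hx hy => simp only [map_add, hx, hy]
  | tmul a x =>
    simp only [actH_tmul]
    congr 1; ext
    change ⁅R.ofH h, ⁅R.ofH k, (x : R.Alg)⁆⁆ = ⁅R.ofH k, ⁅R.ofH h, (x : R.Alg)⁆⁆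
    rw [leibniz_lie, ofH_lie_ofH, zero_lie, zero_add]

/-- The Lie algebra `𝔤' ⊗ A ⊕ 𝔥''` (with the factor `A` written on the left), with bracket
`[X ⊗ a, Y ⊗ b] = [X, Y] ⊗ ab`, `[h, X ⊗ a] = [h, X] ⊗ a`, `[h, h'] = 0`. -/
def Cur : Type (max u v w) := (A ⊗[ℂ] R.derived) × 𝔥''

namespace Cur

instance : AddCommGroup (R.Cur A 𝔥'') :=
  inferInstanceAs (AddCommGroup ((A ⊗[ℂ] R.derived) × 𝔥''))

instance : Module ℂ (R.Cur A 𝔥'') :=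
  inferInstanceAs (Module ℂ ((A ⊗[ℂ] R.derived) × 𝔥''))

/-- The element `t + y` of `𝔤' ⊗ A ⊕ 𝔥''`. -/
def mk (t : A ⊗[ℂ] R.derived) (y : 𝔥'') : R.Cur A 𝔥'' := (t, y)

instance : Bracket (R.Cur A 𝔥'') (R.Cur A 𝔥'') where
  bracket x y := mk R A 𝔥'' (⁅x.1, y.1⁆ + R.actH A x.2 y.1 - R.actH A y.2 x.1) 0

instance : LieRing (R.Cur A 𝔥'') where
  add_lie x y z := by
    refine Prod.ext ?_ (zero_add (0 : 𝔥'')).symm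
    change ⁅x.1 + y.1, z.1⁆ + R.actH A ((x.2 + y.2 : 𝔥'') : 𝔥) z.1 - R.actH A z.2 (x.1 + y.1) =
      (⁅x.1, z.1⁆ + R.actH A x.2 z.1 - R.actH A z.2 x.1) +
        (⁅y.1, z.1⁆ + R.actH A y.2 z.1 - R.actH A z.2 y.1)
    rw [add_lie, Submodule.coe_add, actH_add, map_add]; abel
  lie_add x y z := by
    refine Prod.ext ?_ (zero_add (0 : 𝔥'')).symm
    change ⁅x.1, y.1 + z.1⁆ + R.actH A x.2 (y.1 + z.1) - R.actH A ((y.2 + z.2 : 𝔥'') : 𝔥) x.1 =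
      (⁅x.1, y.1⁆ + R.actH A x.2 y.1 - R.actH A y.2 x.1) +
        (⁅x.1, z.1⁆ + R.actH A x.2 z.1 - R.actH A z.2 x.1)
    rw [lie_add, Submodule.coe_add, actH_add, map_add]; abel
  lie_self x := by
    refine Prod.ext ?_ rfl
    change ⁅x.1, x.1⁆ + R.actH A x.2 x.1 - R.actH A x.2 x.1 = 0
    rw [lie_self]; abel
  leibniz_lie x y z := by
    have h0 (t) : R.actH A ((0 : 𝔥'') : 𝔥) t = 0 := by
      have := R.actH_smul A 0 0 t
      simpa using this
    refine Prod.ext ?_ (zero_add (0 : 𝔥'')).symm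
    change ⁅x.1, ⁅y.1, z.1⁆ + R.actH A y.2 z.1 - R.actH A z.2 y.1⁆ +
        R.actH A x.2 (⁅y.1, z.1⁆ + R.actH A y.2 z.1 - R.actH A z.2 y.1) -
        R.actH A ((0 : 𝔥'') : 𝔥) x.1 =
      (⁅⁅x.1, y.1⁆ + R.actH A x.2 y.1 - R.actH A y.2 x.1, z.1⁆ +
        R.actH A ((0 : 𝔥'') : 𝔥) z.1 -
        R.actH A z.2 (⁅x.1, y.1⁆ + R.actH A x.2 y.1 - R.actH A y.2 x.1)) +
      (⁅y.1, ⁅x.1, z.1⁆ + R.actH A x.2 z.1 - R.actH A z.2 x.1⁆ +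
        R.actH A y.2 (⁅x.1, z.1⁆ + R.actH A x.2 z.1 - R.actH A z.2 x.1) -
        R.actH A ((0 : 𝔥'') : 𝔥) y.1)
    simp only [h0, map_add, map_sub, LieDerivation.apply_lie_eq_add, lie_add, add_lie, lie_sub,
      sub_lie]
    rw [leibniz_lie x.1, R.actH_comm A x.2 y.2 z.1, R.actH_comm A x.2 z.2 y.1,
      R.actH_comm A y.2 z.2 x.1]
    simp only [← lie_skew (R.actH A z.2 x.1) y.1, ← lie_skew (R.actH A y.2 x.1) z.1]
    abel

instance : LieAlgebra ℂ (R.Cur A 𝔥'') where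
  lie_smul c x y := by
    refine Prod.ext ?_ (smul_zero c).symm
    change ⁅x.1, c • y.1⁆ + R.actH A x.2 (c • y.1) - R.actH A ((c • y.2 : 𝔥'') : 𝔥) x.1 =
      c • (⁅x.1, y.1⁆ + R.actH A x.2 y.1 - R.actH A y.2 x.1)
    rw [lie_smul, Submodule.coe_smul, actH_smul, map_smul, smul_sub, smul_add]

end Cur

/-- The universal enveloping algebra of `𝔤' ⊗ A ⊕ 𝔥''`. -/
abbrev U : Type (max u v w) := UniversalEnvelopingAlgebra ℂ (R.Cur A 𝔥'')

/-- `X ⊗ a`, as an element of the enveloping algebra. -/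
def uTensor (a : A) (x : R.derived) : R.U A 𝔥'' :=
  UniversalEnvelopingAlgebra.ι ℂ (Cur.mk R A 𝔥'' (a ⊗ₜ x) 0)

/-- The abelian subalgebra `𝔥' ⊗ A ⊕ 𝔥''`. -/
abbrev CurH : Type (max v w) := (A ⊗[ℂ] R.cartanDerived) × 𝔥''

/-- The inclusion `𝔥' → 𝔤'`. -/
def cartanIncl : R.cartanDerived →ₗ[ℂ] R.derived where
  toFun x := ⟨R.ofH x, x.2⟩
  map_add' x y := by ext; simp
  map_smul' c x := by ext; simp

/-- An element of `𝔥' ⊗ A ⊕ 𝔥''`, as an element of the enveloping algebra. -/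
def uCartan (h : R.CurH A 𝔥'') : R.U A 𝔥'' :=
  UniversalEnvelopingAlgebra.ι ℂ (Cur.mk R A 𝔥'' (R.cartanIncl.lTensor A h.1) h.2)

/-- The element `x ⊗ 1 + y` of `𝔥' ⊗ A ⊕ 𝔥''`, for `x ∈ 𝔥'` and `y ∈ 𝔥''`. If
`𝔥 = 𝔥' ⊕ 𝔥''`, this is how `x + y ∈ 𝔥` is regarded as an element of `𝔥' ⊗ A ⊕ 𝔥''`. -/
def hEmb (x : R.cartanDerived) (y : 𝔥'') : R.CurH A 𝔥'' := ((1 : A) ⊗ₜ x, y)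

/-! ### Highest weight modules and the modules `M(ψ, {I_β})` -/

section Modules

variable {A} {𝔥''}

/-- `M` is a highest weight module with highest weight `ψ` and highest weight vector `v`.
Modules over `𝔤' ⊗ A ⊕ 𝔥''` are modules over its enveloping algebra. The second condition
says that `N^+ ⊗ A`, which is spanned by the `X ⊗ a` with `X` in a positive root space,
kills `v`. -/
structure IsHighestWeight (ψ : Module.Dual ℂ (R.CurH A 𝔥'')) {M : Type*} [AddCommGroup M]
    [Module ℂ M] [Module (R.U A 𝔥'') M] [IsScalarTower ℂ (R.U A 𝔥'') M] (v : M) : Prop where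
  ne_zero : v ≠ 0
  nPlus : ∀ β ∈ R.posRoots, ∀ x : R.derived, (x : R.Alg) ∈ R.rootSpace β → ∀ a : A,
    R.uTensor A 𝔥'' a x • v = 0
  cartan : ∀ h : R.CurH A 𝔥'', R.uCartan A 𝔥'' h • v = ψ h • v
  generates : Submodule.span (R.U A 𝔥'') {v} = ⊤

variable (A) (𝔥'') in
/-- The weight space `{m ∈ M | h m = μ(h) m for all h ∈ 𝔥}`, where `𝔥 = 𝔥' ⊕ 𝔥''`. -/
def weightSpace (M : Type*) [AddCommGroup M] [Module ℂ M] [Module (R.U A 𝔥'') M]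
    [IsScalarTower ℂ (R.U A 𝔥'') M] (μ : Module.Dual ℂ 𝔥) : Submodule ℂ M where
  carrier := {m | ∀ (x : R.cartanDerived) (y : 𝔥''),
    R.uCartan A 𝔥'' (R.hEmb A 𝔥'' x y) • m = μ ((x : 𝔥) + (y : 𝔥)) • m}
  zero_mem' x y := by simp
  add_mem' hm hn x y := by rw [smul_add, hm x y, hn x y, smul_add]
  smul_mem' c m hm x y := by
    rw [← algebraMap_smul (R.U A 𝔥'') c m, ← mul_smul, ← Algebra.commutes, mul_smul, hm x y,
      algebraMap_smul, algebraMap_smul, smul_comm]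

variable (ψ : Module.Dual ℂ (R.CurH A 𝔥''))

/-- The left ideal of the enveloping algebra generated by `N^+ ⊗ A` and by the elements
`h - ψ(h)` for `h ∈ 𝔥' ⊗ A ⊕ 𝔥''`. -/
def vermaIdeal : Submodule (R.U A 𝔥'') (R.U A 𝔥'') :=
  Submodule.span (R.U A 𝔥'')
    ({z | ∃ β ∈ R.posRoots, ∃ x : R.derived, (x : R.Alg) ∈ R.rootSpace β ∧
        ∃ a : A, z = R.uTensor A 𝔥'' a x} ∪
      {z | ∃ h : R.CurH A 𝔥'', z = R.uCartan A 𝔥'' h - algebraMap ℂ (R.U A 𝔥'') (ψ h)})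

/-- The Verma module `M(ψ)`, i.e. the module induced from the one-dimensional representation of
`N^+ ⊗ A ⊕ (𝔥' ⊗ A ⊕ 𝔥'')` on which `N^+ ⊗ A` acts by `0` and `𝔥' ⊗ A ⊕ 𝔥''` acts by `ψ`. -/
abbrev Verma : Type (max u v w) := R.U A 𝔥'' ⧸ R.vermaIdeal ψ

/-- The canonical generator of the Verma module. -/
def vermaVec : R.Verma ψ := Submodule.Quotient.mk 1

/-- The submodule of `M(ψ)` generated by all `(X ⊗ a) v` with `X ∈ 𝔤_{-β}`, `a ∈ I_β`,
`β ∈ Δ^+`. -/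
def relSubmodule (I : R.posRoots → Ideal A) : Submodule (R.U A 𝔥'') (R.Verma ψ) :=
  Submodule.span (R.U A 𝔥'')
    {z | ∃ β : R.posRoots, ∃ x : R.derived,
      (x : R.Alg) ∈ R.rootSpace (-(β : Module.Dual ℂ 𝔥)) ∧
        ∃ a ∈ I β, z = R.uTensor A 𝔥'' a x • R.vermaVec ψ}

/-- The module `M(ψ, {I_β})`. -/
abbrev MMod (I : R.posRoots → Ideal A) : Type (max u v w) := R.Verma ψ ⧸ R.relSubmodule ψ I

/-- The image in `M(ψ, {I_β})` of the canonical generator of the Verma module. -/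
def mVec (I : R.posRoots → Ideal A) : R.MMod ψ I := Submodule.Quotient.mk (R.vermaVec ψ)

end Modules

end Realization

end KacMoody

end

/-!
The proof has two independent halves.

*The generator survives.* It suffices to find a module over `𝔤' ⊗ A ⊕ 𝔥''` with a nonzero vector `w`
that satisfies all the relations imposed on the generator of `M(ψ, {I_β})`. As `ψ` vanishes on
`𝔥' ⊗ I` it comes from a linear form on `𝔥' ⊗ B ⊕ 𝔥''`, with `B = A/I`, and the module is pulled back
from a highest weight module of `𝔤' ⊗ B ⊕ 𝔥''`; there `X ⊗ a` acts by zero for every `a ∈ I`, hence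
for every `a ∈ I_β` (`Realization.vermaVec_notMem_relSubmodule`).
Highest weight modules for arbitrary `ψ` exist by the following substitute for the
Poincaré–Birkhoff–Witt theorem (`exists_induced_action`). If a Lie algebra is `L = n ⊕ b` with
subalgebras `n` and `b`, and `χ` is a character of `b`, then `n` acts on `Hom(L, U(n))` by
`(y D)(x) = y D(x) - D([y, x])`, so `U(n)` does as well. Applying `u ∈ U(n)` to the map
`D(1) : y + x ↦ y + χ(x)` gives `D(u) : L → U(n)`, and `x u := D(u)(x)` is an action of `L` on `U(n)`
in which `b` acts on `1 ≠ 0` by `χ`. For `L = 𝔤' ⊗ B ⊕ 𝔥''` the subalgebras `n` and `b` are the parts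
of negative and of nonnegative degree for the principal grading, that is, for the eigenspaces of
`ad h₀`, where `α_i(h₀) = 1` for all `i`.

This uses that the degree zero part of `𝔤` is a copy of `𝔥`. It is the image of `𝔥` by the triangular
decomposition (`IsChevalley.triangular`). The map from `𝔥` is injective (`Realization.ofH_injective`):
the auxiliary algebra acts on the free associative algebra on the `f_i` with any given weight for
`1`, so `𝔥` embeds into it, and an ideal that meets `𝔥` trivially is graded, so that it lies in the
sum of the parts of nonzero degree; hence so does the sum of all these ideals.

*The weight spaces are finite-dimensional.* The module is spanned by the layers `M_k`, where `M_k` is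
the span of the `(f_{i₁} ⊗ a₁) ⋯ (f_{iₖ} ⊗ aₖ) v`, and `h₀` acts on `M_k` by the scalar `λ(h₀) - k`, so
each weight space lies in a single layer. By induction on `k`, for each iterated bracket `X` of the
`f_i` there is an ideal `J` of finite codimension such that `X ⊗ J` kills `M_k`
(`Realization.exists_cofg_ideal_layer`). For `k = 0` this follows from the relations for the simple
roots alone, since in a finitely generated algebra products of ideals of finite codimension have
finite codimension; the induction step is
`(X ⊗ a)(f_i ⊗ b) m = (f_i ⊗ b)(X ⊗ a) m + ([X, f_i] ⊗ ab) m`. With `X = f_i`, the layer `M_{k+1}` is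
the image of a sum of spaces `A/J ⊗ M_k`, and so the layers are finite-dimensional.
-/

noncomputable section

namespace KacMoody

universe u v w

attribute [local instance] LieRing.ofAssociativeRing

/-! ### Eigenspaces and induced modules -/

section

section LinearAlgebra

variable {K V : Type*} [Field K] [AddCommGroup V] [Module K V]

theorem disjoint_eigenspace_iSup_ne (D : Module.End K V) (c : K) :
    Disjoint (D.eigenspace c) (⨆ (μ : K) (_ : μ ≠ c), D.eigenspace μ) :=
  D.eigenspaces_iSupIndep c

/-- A subspace of the `c`-eigenspace which, together with the other eigenspaces, spans the whole
space is the full `c`-eigenspace. -/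
theorem eigenspace_le_of_le_sup (D : Module.End K V) (c : K) (S : Submodule K V)
    (hS : S ≤ D.eigenspace c) (h : ⊤ ≤ S ⊔ ⨆ (μ : K) (_ : μ ≠ c), D.eigenspace μ) :
    D.eigenspace c ≤ S := by
  intro x hx
  obtain ⟨s, hs, y, hy, rfl⟩ := Submodule.mem_sup.1 (h (Submodule.mem_top (x := x)))
  have hy' : y ∈ D.eigenspace c := by
    simpa using sub_mem hx (hS hs)
  have : y = 0 := Submodule.disjoint_def.1 (disjoint_eigenspace_iSup_ne D c) y hy' hy
  simpa [this] using hs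

end LinearAlgebra

section Induced

variable {K L : Type*} [Field K] [LieRing L] [LieAlgebra K L]

theorem lie_mem_eigenspace_ad_add (z : L) {a b : K} {x y : L}
    (hx : x ∈ (LieAlgebra.ad K L z).eigenspace a) (hy : y ∈ (LieAlgebra.ad K L z).eigenspace b) :
    ⁅x, y⁆ ∈ (LieAlgebra.ad K L z).eigenspace (a + b) := by
  simp only [Module.End.mem_eigenspace_iff, LieAlgebra.ad_apply] at *
  rw [leibniz_lie, hx, hy, smul_lie, lie_smul, add_smul]

/-- The enveloping algebra is the smallest subspace that contains `1` and is stable under left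
multiplication by the elements of the Lie algebra. -/
theorem universalEnveloping_eq_top_of_mul_mem
    (p : Submodule K (UniversalEnvelopingAlgebra K L)) (h1 : 1 ∈ p)
    (hι : ∀ y : L, ∀ u ∈ p, UniversalEnvelopingAlgebra.ι K y * u ∈ p) : p = ⊤ := by
  let S : Subalgebra K (UniversalEnvelopingAlgebra K L) :=
    { carrier := {a | ∀ u ∈ p, a * u ∈ p}
      mul_mem' := fun ha hb u hu => by rw [mul_assoc]; exact ha _ (hb _ hu)
      add_mem' := fun ha hb u hu => by rw [add_mul]; exact add_mem (ha _ hu) (hb _ hu)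
      algebraMap_mem' := fun r u hu => by
        rw [← Algebra.smul_def]; exact p.smul_mem r hu }
  let f : L →ₗ⁅K⁆ S :=
    { toFun := fun y => ⟨UniversalEnvelopingAlgebra.ι K y, hι y⟩
      map_add' := fun x y => by ext; simp
      map_smul' := fun c x => by ext; simp
      map_lie' := fun {x y} => by
        ext
        simp only [LieHom.map_lie]
        rfl }
  have hf : S.val.comp (UniversalEnvelopingAlgebra.lift K f) = AlgHom.id K _ := by
    ext y
    simp [f]
  refine eq_top_iff.2 fun u _ => ?_
  have hu : u ∈ S := by
    have := (UniversalEnvelopingAlgebra.lift K f u).2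
    have h2 : ((UniversalEnvelopingAlgebra.lift K f u : S) : UniversalEnvelopingAlgebra K L) = u :=
      DFunLike.congr_fun hf u
    rwa [h2] at this
  simpa using hu 1 h1

instance : Nontrivial (UniversalEnvelopingAlgebra K L) :=
  (UniversalEnvelopingAlgebra.lift K (0 : L →ₗ⁅K⁆ K)).toRingHom.domain_nontrivial

/-- The action of a subalgebra `n` on the linear maps from `L` to the enveloping algebra of `n`:
the element `y` sends `D` to `x ↦ y D(x) - D([y, x])`. -/
def homAction (n : LieSubalgebra K L) :
    n →ₗ⁅K⁆ Module.End K (L →ₗ[K] UniversalEnvelopingAlgebra K n) where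
  toFun y :=
    { toFun := fun D => (LinearMap.mulLeft K (UniversalEnvelopingAlgebra.ι K y)).comp D -
        D.comp (LieAlgebra.ad K L (y : L))
      map_add' := fun D D' => by
        rw [LinearMap.comp_add, LinearMap.add_comp]; abel
      map_smul' := fun c D => by
        rw [LinearMap.comp_smul, LinearMap.smul_comp, RingHom.id_apply, smul_sub] }
  map_add' y y' := by
    ext D x
    change UniversalEnvelopingAlgebra.ι K (y + y') * D x - D ⁅((y : L) + y'), x⁆ =
      (UniversalEnvelopingAlgebra.ι K y * D x - D ⁅(y : L), x⁆) +
      (UniversalEnvelopingAlgebra.ι K y' * D x - D ⁅(y' : L), x⁆)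
    rw [map_add, add_mul, add_lie, map_add]; abel
  map_smul' c y := by
    ext D x
    change UniversalEnvelopingAlgebra.ι K (c • y) * D x - D ⁅(c • (y : L)), x⁆ =
      c • (UniversalEnvelopingAlgebra.ι K y * D x - D ⁅(y : L), x⁆)
    rw [map_smul, smul_mul_assoc, smul_lie, map_smul, smul_sub]
  map_lie' {y y'} := by
    ext D x
    change UniversalEnvelopingAlgebra.ι K ⁅y, y'⁆ * D x - D ⁅⁅(y : L), (y' : L)⁆, x⁆ =
      (UniversalEnvelopingAlgebra.ι K y *
          (UniversalEnvelopingAlgebra.ι K y' * D x - D ⁅(y' : L), x⁆) -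
        (UniversalEnvelopingAlgebra.ι K y' * D ⁅(y : L), x⁆ - D ⁅(y' : L), ⁅(y : L), x⁆⁆)) -
      (UniversalEnvelopingAlgebra.ι K y' *
          (UniversalEnvelopingAlgebra.ι K y * D x - D ⁅(y : L), x⁆) -
        (UniversalEnvelopingAlgebra.ι K y * D ⁅(y' : L), x⁆ - D ⁅(y : L), ⁅(y' : L), x⁆⁆))
    rw [LieHom.map_lie, LieRing.of_associative_ring_bracket, lie_lie, map_sub]
    simp only [sub_mul, mul_sub, mul_assoc]
    abel

/-- If `L = n ⊕ b` for subalgebras `n` and `b`, and `χ` restricts to a character of `b`, then the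
enveloping algebra of `n` carries an action of `L` for which `b` acts on `1` by `χ`.

The operators `D(u) : x ↦ x u` that describe the action are obtained from
`D(1) : y + x ↦ y + χ(x)`, for `y ∈ n` and `x ∈ b`, by letting the enveloping algebra of `n` act
on the linear maps from `L` to itself; no basis of the enveloping algebra is needed. -/
theorem exists_induced_action (n b : LieSubalgebra K L)
    (hc : IsCompl n.toSubmodule b.toSubmodule) (χ : L →ₗ[K] K)
    (hχ : ∀ x ∈ b, ∀ y ∈ b, χ ⁅x, y⁆ = 0) :
    ∃ ρ : L →ₗ⁅K⁆ Module.End K (UniversalEnvelopingAlgebra K n),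
      ∀ x ∈ b, ρ x 1 = χ x • 1 := by
  let U := UniversalEnvelopingAlgebra K n
  let P : L →ₗ[K] n := Submodule.projectionOnto n.toSubmodule b.toSubmodule hc
  have hPn (y : n) : P y = y := Submodule.projectionOnto_apply_left hc y
  have hPb (x : L) (hx : x ∈ b) : P x = 0 := Submodule.projectionOnto_apply_right hc ⟨x, hx⟩
  let D1 : L →ₗ[K] U := (UniversalEnvelopingAlgebra.ι K : n →ₗ⁅K⁆ U).toLinearMap.comp P +
    (Algebra.linearMap K U).comp (χ.comp (LinearMap.id - n.toSubmodule.subtype.comp P))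
  have hD1n (y : n) : D1 y = UniversalEnvelopingAlgebra.ι K y := by
    change UniversalEnvelopingAlgebra.ι K (P y) + algebraMap K U (χ ((y : L) - (P y : L))) = _
    rw [hPn, sub_self, map_zero, map_zero, add_zero]
  have hD1b (x : L) (hx : x ∈ b) : D1 x = algebraMap K U (χ x) := by
    change UniversalEnvelopingAlgebra.ι K (P x) + algebraMap K U (χ (x - (P x : L))) = _
    rw [hPb x hx, map_zero, zero_add, ZeroMemClass.coe_zero, sub_zero]
  let Φ := UniversalEnvelopingAlgebra.lift K (homAction n)
  let B : L →ₗ[K] Module.End K U := (Φ.toLinearMap.flip D1).flip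
  have hB1 (x : L) : B x 1 = D1 x := by
    change Φ 1 D1 x = D1 x
    rw [map_one]; rfl
  have hBι (x : L) (y : n) (u : U) : B x (UniversalEnvelopingAlgebra.ι K y * u) =
      UniversalEnvelopingAlgebra.ι K y * B x u + B ⁅x, (y : L)⁆ u := by
    change Φ (UniversalEnvelopingAlgebra.ι K y * u) D1 x = _
    rw [map_mul, UniversalEnvelopingAlgebra.lift_ι_apply]
    change UniversalEnvelopingAlgebra.ι K y * Φ u D1 x - Φ u D1 ⁅(y : L), x⁆ = _
    rw [← lie_skew, map_neg, sub_neg_eq_add]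
    rfl
  have hBn (y : n) (u : U) : B y u = UniversalEnvelopingAlgebra.ι K y * u := by
    have key := universalEnveloping_eq_top_of_mul_mem
      (⨅ y : n, LinearMap.eqLocus (B y) (LinearMap.mulLeft K (UniversalEnvelopingAlgebra.ι K y)))
      (by
        simp only [Submodule.mem_iInf, LinearMap.mem_eqLocus]
        intro y
        rw [hB1, hD1n, LinearMap.mulLeft_apply, mul_one])
      (fun z u hu => by
        simp only [Submodule.mem_iInf, LinearMap.mem_eqLocus, LinearMap.mulLeft_apply] at hu ⊢
        intro y
        have h2 : ⁅(y : L), (z : L)⁆ = ((⁅y, z⁆ : n) : L) := rfl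
        rw [hBι, hu, h2, hu, LieHom.map_lie, LieRing.of_associative_ring_bracket, sub_mul]
        simp only [mul_assoc]
        abel)
    have h := Submodule.mem_top (x := u) (R := K)
    rw [← key] at h
    simp only [Submodule.mem_iInf, LinearMap.mem_eqLocus, LinearMap.mulLeft_apply] at h
    exact h y
  have hB_nL (y : n) (x : L) (u : U) : B ⁅x, (y : L)⁆ u = B x (B y u) - B y (B x u) := by
    rw [hBn, hBn, hBι]; abel
  have hB1' (x y : L) : B ⁅x, y⁆ 1 = B x (B y 1) - B y (B x 1) := by
    have dec (x : L) : ∃ y : n, ∃ z ∈ b, x = y + z := by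
      obtain ⟨y, hy, z, hz, h⟩ := Submodule.mem_sup.1
        (hc.sup_eq_top.ge (Submodule.mem_top (x := x)))
      exact ⟨⟨y, hy⟩, z, hz, h.symm⟩
    obtain ⟨x₁, x₂, hx₂, rfl⟩ := dec x
    obtain ⟨y₁, y₂, hy₂, rfl⟩ := dec y
    have h22 : B ⁅x₂, y₂⁆ 1 = B x₂ (B y₂ 1) - B y₂ (B x₂ 1) := by
      have hb (x : L) (hx : x ∈ b) : B x 1 = χ x • (1 : U) := by
        rw [hB1, hD1b x hx, Algebra.algebraMap_eq_smul_one]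
      rw [hb _ (b.lie_mem hx₂ hy₂), hχ _ hx₂ _ hy₂, hb _ hy₂, hb _ hx₂, map_smul, map_smul,
        hb _ hy₂, hb _ hx₂, smul_smul, smul_smul, mul_comm, sub_self, zero_smul]
    have h12 : B ⁅(x₁ : L), y₂⁆ 1 = B x₁ (B y₂ 1) - B y₂ (B x₁ 1) := by
      rw [← lie_skew, map_neg, LinearMap.neg_apply, hB_nL]; abel
    simp only [add_lie, lie_add, map_add, LinearMap.add_apply, hB_nL, h22, h12]
    abel
  refine ⟨{ B with map_lie' := ?_ }, fun x hx => ?_⟩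
  · intro x y
    have key := universalEnveloping_eq_top_of_mul_mem
      (⨅ p : L × L, LinearMap.eqLocus (B ⁅p.1, p.2⁆) (B p.1 * B p.2 - B p.2 * B p.1))
      (by
        simp only [Submodule.mem_iInf, LinearMap.mem_eqLocus]
        intro p
        exact hB1' p.1 p.2)
      (fun z u hu => by
        simp only [Submodule.mem_iInf, LinearMap.mem_eqLocus, Prod.forall, LinearMap.sub_apply,
          Module.End.mul_apply] at hu ⊢
        intro x y
        simp only [hBι, map_add]
        rw [hu, lie_lie, map_sub, LinearMap.sub_apply, hu x ⁅y, (z : L)⁆, hu y ⁅x, (z : L)⁆, mul_sub]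
        abel)
    ext u
    have h := Submodule.mem_top (x := u) (R := K)
    rw [← key] at h
    simp only [Submodule.mem_iInf, LinearMap.mem_eqLocus, Prod.forall] at h
    exact h x y
  · change B x 1 = _
    rw [hB1, hD1b x hx, Algebra.algebraMap_eq_smul_one]

end Induced

end

/-! ### Highest weight modules of graded Lie algebras -/

section

section Graded

variable {K : Type u} {L : Type v} [Field K] [LieRing L] [LieAlgebra K L]

theorem lie_mem_of_mem_iSup {κ : Type*} (p : κ → Submodule K L) (N : Submodule K L)
    (h : ∀ i j, ∀ x ∈ p i, ∀ y ∈ p j, ⁅x, y⁆ ∈ N) {x y : L} (hx : x ∈ ⨆ i, p i)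
    (hy : y ∈ ⨆ i, p i) : ⁅x, y⁆ ∈ N := by
  induction hx using Submodule.iSup_induction' with
  | zero => simp
  | add a b _ _ ha hb => rw [add_lie]; exact add_mem ha hb
  | mem i a ha =>
    induction hy using Submodule.iSup_induction' with
    | zero => simp
    | add c d _ _ hc hd => rw [lie_add]; exact add_mem hc hd
    | mem j c hc => exact h i j a ha c hc

/-- Let `ad z` be diagonalizable with integral eigenvalues, and let `χ` be a functional which
vanishes on the eigenspaces of nonzero eigenvalue and on the brackets of elements that commute
with `z`. Then there is an `L`-module with a nonzero vector on which the eigenspaces of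
nonnegative eigenvalue act by `χ`. -/
theorem exists_highestWeight_action [CharZero K] (z : L)
    (htop : ⨆ k : ℤ, (LieAlgebra.ad K L z).eigenspace (k : K) = ⊤) (χ : L →ₗ[K] K)
    (hχ0 : ∀ x ∈ (LieAlgebra.ad K L z).eigenspace 0,
      ∀ y ∈ (LieAlgebra.ad K L z).eigenspace 0, χ ⁅x, y⁆ = 0)
    (hχ : ∀ μ ≠ 0, ∀ x ∈ (LieAlgebra.ad K L z).eigenspace μ, χ x = 0) :
    ∃ (W : Type (max u v)) (_ : AddCommGroup W) (_ : Module K W) (ρ : L →ₗ⁅K⁆ Module.End K W) (w : W),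
      w ≠ 0 ∧ ∀ k : ℕ, ∀ x ∈ (LieAlgebra.ad K L z).eigenspace (k : K), ρ x w = χ x • w := by
  let E (μ : K) := (LieAlgebra.ad K L z).eigenspace μ
  let n : LieSubalgebra K L :=
    { (⨆ k : ℕ, E (-((k : K) + 1)) : Submodule K L) with
      lie_mem' := fun {x y} hx hy => lie_mem_of_mem_iSup _ _ (fun i j a ha b hb => by
        refine Submodule.mem_iSup_of_mem (i + j + 1) ?_
        have := lie_mem_eigenspace_ad_add z ha hb
        convert this using 2
        push_cast; ring) hx hy }
  let b : LieSubalgebra K L :=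
    { (⨆ k : ℕ, E (k : K) : Submodule K L) with
      lie_mem' := fun {x y} hx hy => lie_mem_of_mem_iSup _ _ (fun i j a ha b hb => by
        refine Submodule.mem_iSup_of_mem (i + j) ?_
        have := lie_mem_eigenspace_ad_add z ha hb
        convert this using 2
        push_cast; ring) hx hy }
  have hc : IsCompl n.toSubmodule b.toSubmodule := by
    change IsCompl (⨆ k : ℕ, E (-((k : K) + 1))) (⨆ k : ℕ, E (k : K))
    constructor
    · have hind : iSupIndep fun k : ℤ => E k :=
        (LieAlgebra.ad K L z).eigenspaces_iSupIndep.comp Int.cast_injective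
      refine (hind.disjoint_biSup_biSup (s := Set.Iio 0) (t := Set.Ici 0) ?_).mono ?_ ?_
      · exact Set.disjoint_left.2 fun k hk hk' => absurd (Set.mem_Iio.1 hk) (not_lt.2 hk')
      · refine iSup_le fun k => ?_
        refine le_iSup₂_of_le (-((k : ℤ) + 1)) (Set.mem_Iio.2 (by omega)) ?_
        push_cast; exact le_rfl
      · refine iSup_le fun k => ?_
        refine le_iSup₂_of_le (k : ℤ) (Set.mem_Ici.2 (by omega)) ?_
        push_cast; exact le_rfl
    · rw [codisjoint_iff, eq_top_iff, ← htop]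
      refine iSup_le fun k => ?_
      obtain ⟨m, rfl⟩ | ⟨m, rfl⟩ : (∃ m : ℕ, k = m) ∨ ∃ m : ℕ, k = -((m : ℤ) + 1) := by
        rcases le_or_gt 0 k with h | h
        · exact .inl ⟨k.toNat, by omega⟩
        · exact .inr ⟨(-k - 1).toNat, by omega⟩
      · refine le_sup_of_le_right (le_iSup_of_le m ?_)
        push_cast; exact le_rfl
      · refine le_sup_of_le_left (le_iSup_of_le m ?_)
        push_cast; exact le_rfl
  obtain ⟨ρ, hρ⟩ := exists_induced_action n b hc χ (fun x hx y hy => by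
    refine lie_mem_of_mem_iSup (fun k : ℕ => E (k : K)) (LinearMap.ker χ) ?_ hx hy
    intro i j x hx y hy
    rw [LinearMap.mem_ker]
    by_cases h : (i : K) + j = 0
    · have h' : i + j = 0 := by exact_mod_cast h
      obtain ⟨rfl, rfl⟩ : i = 0 ∧ j = 0 := by omega
      rw [Nat.cast_zero] at hx hy
      exact hχ0 x hx y hy
    · exact hχ _ h _ (lie_mem_eigenspace_ad_add z hx hy))
  exact ⟨_, inferInstance, inferInstance, ρ, 1, one_ne_zero, fun k x hx =>
    hρ x (Submodule.mem_iSup_of_mem (p := fun k : ℕ => E (k : K)) k hx)⟩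

end Graded

end

/-! ### Words in the Chevalley generators and the triangular decomposition -/

section

/-- The right-normed brackets `[e_{i₁}, [e_{i₂}, …, e_{iₙ}]]`, with `n ≥ 1`, in a family `e`. -/
inductive IsWord {ι L : Type*} [LieRing L] (e : ι → L) : L → Prop
  | base (i : ι) : IsWord e (e i)
  | step (i : ι) {x : L} (hx : IsWord e x) : IsWord e ⁅e i, x⁆

/-- The span of the right-normed brackets in a family. -/
def wordSpan {ι L : Type*} [LieRing L] [LieAlgebra ℂ L] (e : ι → L) : Submodule ℂ L :=
  Submodule.span ℂ {x | IsWord e x}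

section Words

variable {ι L : Type*} [LieRing L] [LieAlgebra ℂ L] {e : ι → L}

theorem IsWord.mem_wordSpan {x : L} (h : IsWord e x) : x ∈ wordSpan e :=
  Submodule.subset_span h

theorem lie_mem_wordSpan (i : ι) {x : L} (h : x ∈ wordSpan e) : ⁅e i, x⁆ ∈ wordSpan e := by
  induction h using Submodule.span_induction with
  | mem x hx => exact (IsWord.step i hx).mem_wordSpan
  | zero => simp
  | add x y _ _ hx hy => rw [lie_add]; exact add_mem hx hy
  | smul c x _ hx => rw [lie_smul]; exact Submodule.smul_mem _ _ hx

variable {𝔥 : Type*} [AddCommGroup 𝔥] [Module ℂ 𝔥] {H : 𝔥 →ₗ[ℂ] L}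
  {root : ι → Module.Dual ℂ 𝔥}

/-- Brackets of `n` weight vectors `e_i`, of weights `r α_i`, are weight vectors; the weight,
divided by `r`, takes the value `n` at any `h₀` with `α_i(h₀) = 1` for all `i`. -/
theorem IsWord.exists_weight (r : ℂ) (he : ∀ h i, ⁅H h, e i⁆ = (r * root i h) • e i) {h₀ : 𝔥}
    (h1 : ∀ i, root i h₀ = 1) {x : L} (hx : IsWord e x) :
    ∃ (β : Module.Dual ℂ 𝔥) (n : ℕ), β h₀ = n + 1 ∧ ∀ h, ⁅H h, x⁆ = (r * β h) • x := by
  induction hx with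
  | base i => exact ⟨root i, 0, by simp [h1], fun h => he h i⟩
  | step i _ ih =>
    obtain ⟨β, n, hβ, hx⟩ := ih
    refine ⟨root i + β, n + 1, by simp [h1, hβ, add_comm], fun h => ?_⟩
    rw [leibniz_lie, he, hx, smul_lie, lie_smul, ← add_smul, LinearMap.add_apply, mul_add]

theorem lie_mem_wordSpan_of_weight (r : ℂ) (he : ∀ h i, ⁅H h, e i⁆ = (r * root i h) • e i)
    {h₀ : 𝔥} (h1 : ∀ i, root i h₀ = 1) (h : 𝔥) {x : L} (hx : x ∈ wordSpan e) :
    ⁅H h, x⁆ ∈ wordSpan e := by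
  induction hx using Submodule.span_induction with
  | mem x hx =>
    obtain ⟨β, _, -, hβ⟩ := IsWord.exists_weight r he h1 hx
    rw [hβ]; exact Submodule.smul_mem _ _ (IsWord.mem_wordSpan hx)
  | zero => simp
  | add x y _ _ hx hy => rw [lie_add]; exact add_mem hx hy
  | smul c x _ hx => rw [lie_smul]; exact Submodule.smul_mem _ _ hx

theorem lie_mem_wordSpan_sup_range (r : ℂ) (he : ∀ h i, ⁅H h, e i⁆ = (r * root i h) • e i)
    {h₀ : 𝔥} (h1 : ∀ i, root i h₀ = 1) {f : L} (hf : ∀ i, ⁅f, e i⁆ ∈ LinearMap.range H) {x : L}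
    (hx : x ∈ wordSpan e) : ⁅f, x⁆ ∈ wordSpan e ⊔ LinearMap.range H := by
  induction hx using Submodule.span_induction with
  | mem x hx =>
    induction hx with
    | base i => exact Submodule.mem_sup_right (hf i)
    | @step i x hx ih =>
      rw [leibniz_lie]
      refine add_mem ?_ ?_
      · obtain ⟨h, hh⟩ := hf i
        rw [← hh]
        exact Submodule.mem_sup_left (lie_mem_wordSpan_of_weight r he h1 h hx.mem_wordSpan)
      · obtain ⟨y, hy, z, ⟨h, rfl⟩, hyz⟩ := Submodule.mem_sup.1 ih
        rw [← hyz, lie_add, ← lie_skew (e i) (H h), he]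
        exact Submodule.mem_sup_left (add_mem (lie_mem_wordSpan i hy)
          (neg_mem (Submodule.smul_mem _ _ (IsWord.base i).mem_wordSpan)))
  | zero => simp
  | add x y _ _ hx hy => rw [lie_add]; exact add_mem hx hy
  | smul c x _ hx => rw [lie_smul]; exact Submodule.smul_mem _ _ hx

end Words

variable {ι : Type u} [Fintype ι] {C : Matrix ι ι ℤ}
  {𝔥 : Type v} [AddCommGroup 𝔥] [Module ℂ 𝔥]

/-- The elements `H h`, `e_i`, `f_i` generate the Lie algebra `L` and satisfy the relations of
the auxiliary algebra. This holds for every quotient of the auxiliary algebra. -/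
structure IsChevalley (R : Realization C 𝔥) {L : Type*} [LieRing L] [LieAlgebra ℂ L]
    (H : 𝔥 →ₗ[ℂ] L) (e f : ι → L) : Prop where
  hh : ∀ x y, ⁅H x, H y⁆ = 0
  he : ∀ x i, ⁅H x, e i⁆ = R.root i x • e i
  hf : ∀ x i, ⁅H x, f i⁆ = -(R.root i x • f i)
  ef : ∀ i, ⁅e i, f i⁆ = H (R.coroot i)
  ef_ne : ∀ i j, i ≠ j → ⁅e i, f j⁆ = 0
  generates : ∀ S : LieSubalgebra ℂ L, (∀ x, H x ∈ S) → (∀ i, e i ∈ S) → (∀ i, f i ∈ S) → S = ⊤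

/-- The sum of the fundamental coweights: an element `h₀` with `α_i(h₀) = 1` for all `i`. -/
theorem Realization.exists_root_eq_one (R : Realization C 𝔥) : ∃ h₀, ∀ i, R.root i h₀ = 1 := by
  classical
  let T : 𝔥 →ₗ[ℂ] ι → ℂ := LinearMap.pi R.root
  have hT : Function.Surjective T := by
    rw [← LinearMap.dualMap_injective_iff, ← LinearMap.ker_eq_bot, LinearMap.ker_eq_bot']
    intro g hg
    have h2 : ∑ i, g (Pi.single i 1) • R.root i = 0 := by
      ext x
      have := LinearMap.congr_fun hg x
      rw [LinearMap.dualMap_apply, ← Finset.univ_sum_single (T x), map_sum] at this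
      simp only [LinearMap.zero_apply, LinearMap.sum_apply, LinearMap.smul_apply] at this ⊢
      rw [← this]
      refine Finset.sum_congr rfl fun i _ => ?_
      have h3 : Pi.single i (T x i) = T x i • (Pi.single i 1 : ι → ℂ) := by
        rw [← Pi.single_smul, smul_eq_mul, mul_one]
      rw [h3, map_smul, smul_eq_mul, smul_eq_mul, mul_comm]
      rfl
    have h3 := Fintype.linearIndependent_iff.1 R.linearIndependent_root _ h2
    refine LinearMap.pi_ext' fun i => LinearMap.ext_ring ?_
    simpa using h3 i
  obtain ⟨h₀, h⟩ := hT fun _ => 1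
  exact ⟨h₀, fun i => congr_fun h i⟩

namespace IsChevalley

variable {R : Realization C 𝔥} {L : Type*} [LieRing L] [LieAlgebra ℂ L] {H : 𝔥 →ₗ[ℂ] L}
  {e f : ι → L}

theorem he' (hL : IsChevalley R H e f) (h : 𝔥) (i : ι) : ⁅H h, e i⁆ = ((1 : ℂ) * R.root i h) • e i := by
  rw [one_mul, hL.he]

theorem hf' (hL : IsChevalley R H e f) (h : 𝔥) (i : ι) : ⁅H h, f i⁆ = ((-1 : ℂ) * R.root i h) • f i := by
  rw [neg_one_mul, neg_smul, hL.hf]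

theorem ef_mem (hL : IsChevalley R H e f) (i j : ι) : ⁅e i, f j⁆ ∈ LinearMap.range H := by
  by_cases h : i = j
  · subst h; rw [hL.ef]; exact ⟨_, rfl⟩
  · rw [hL.ef_ne i j h]; exact zero_mem _

/-- The triangular decomposition: `L` is spanned by the brackets of the `f_i`, by `𝔥`, and by the
brackets of the `e_i`. -/
theorem triangular (hL : IsChevalley R H e f) :
    wordSpan f ⊔ LinearMap.range H ⊔ wordSpan e = ⊤ := by
  obtain ⟨h₀, h1⟩ := R.exists_root_eq_one
  set S : Submodule ℂ L := wordSpan f ⊔ LinearMap.range H ⊔ wordSpan e with hS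
  have hfS : wordSpan f ≤ S := le_sup_of_le_left le_sup_left
  have hHS : LinearMap.range H ≤ S := le_sup_of_le_left le_sup_right
  have heS : wordSpan e ≤ S := le_sup_right
  have split (g : L) (h₁ : ∀ x ∈ wordSpan f, ⁅g, x⁆ ∈ S) (h₂ : ∀ h, ⁅g, H h⁆ ∈ S)
      (h₃ : ∀ x ∈ wordSpan e, ⁅g, x⁆ ∈ S) : ∀ x ∈ S, ⁅g, x⁆ ∈ S := by
    intro x hx
    obtain ⟨y, hy, z, hz, rfl⟩ := Submodule.mem_sup.1 hx
    obtain ⟨a, ha, _, ⟨b, rfl⟩, rfl⟩ := Submodule.mem_sup.1 hy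
    rw [lie_add, lie_add]
    exact add_mem (add_mem (h₁ a ha) (h₂ b)) (h₃ z hz)
  have heI (i : ι) : e i ∈ wordSpan e := (IsWord.base i).mem_wordSpan
  have hfI (i : ι) : f i ∈ wordSpan f := (IsWord.base i).mem_wordSpan
  let T : LieSubalgebra ℂ L :=
    { carrier := {g | g ∈ S ∧ ∀ x ∈ S, ⁅g, x⁆ ∈ S}
      zero_mem' := ⟨zero_mem _, fun x _ => by simp⟩
      add_mem' := fun hx hy => ⟨add_mem hx.1 hy.1, fun z hz => by
        rw [add_lie]; exact add_mem (hx.2 z hz) (hy.2 z hz)⟩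
      smul_mem' := fun c x hx => ⟨S.smul_mem c hx.1, fun z hz => by
        rw [smul_lie]; exact S.smul_mem c (hx.2 z hz)⟩
      lie_mem' := fun {x y} hx hy => ⟨hx.2 y hy.1, fun z hz => by
        rw [lie_lie]
        exact sub_mem (hx.2 _ (hy.2 z hz)) (hy.2 _ (hx.2 z hz))⟩ }
  have hT : T = ⊤ := by
    refine hL.generates T (fun x => ⟨hHS ⟨x, rfl⟩, ?_⟩) (fun i => ⟨heS (heI i), ?_⟩)
      (fun i => ⟨hfS (hfI i), ?_⟩)
    · exact split _ (fun y hy => hfS (lie_mem_wordSpan_of_weight (-1) hL.hf' h1 x hy))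
        (fun h => by rw [hL.hh]; exact zero_mem _)
        (fun y hy => heS (lie_mem_wordSpan_of_weight 1 hL.he' h1 x hy))
    · refine split _ (fun y hy => ?_) (fun h => ?_) (fun y hy => heS (lie_mem_wordSpan i hy))
      · exact sup_le hfS hHS (lie_mem_wordSpan_sup_range (-1) hL.hf' h1 (hL.ef_mem i) hy)
      · rw [← lie_skew, hL.he]
        exact neg_mem (S.smul_mem _ (heS (heI i)))
    · refine split _ (fun y hy => hfS (lie_mem_wordSpan i hy)) (fun h => ?_) (fun y hy => ?_)
      · rw [← lie_skew, hL.hf]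
        exact neg_mem (neg_mem (S.smul_mem _ (hfS (hfI i))))
      · refine sup_le heS hHS (lie_mem_wordSpan_sup_range 1 hL.he' h1 (fun j => ?_) hy)
        rw [← lie_skew]
        exact neg_mem (hL.ef_mem j i)
  refine eq_top_iff.2 fun x _ => ?_
  have hx : x ∈ T := by rw [hT]; exact LieSubalgebra.mem_top x
  exact hx.1

theorem wordSpan_e_le (hL : IsChevalley R H e f) {h₀ : 𝔥} (h1 : ∀ i, R.root i h₀ = 1) :
    wordSpan e ≤ ⨆ n : ℕ, (LieAlgebra.ad ℂ L (H h₀)).eigenspace ((n : ℂ) + 1) := by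
  refine Submodule.span_le.2 fun x hx => ?_
  obtain ⟨β, n, hβ, h⟩ := IsWord.exists_weight 1 hL.he' h1 hx
  refine Submodule.mem_iSup_of_mem n ?_
  rw [Module.End.mem_eigenspace_iff, LieAlgebra.ad_apply, h, hβ, one_mul]

theorem wordSpan_f_le (hL : IsChevalley R H e f) {h₀ : 𝔥} (h1 : ∀ i, R.root i h₀ = 1) :
    wordSpan f ≤ ⨆ n : ℕ, (LieAlgebra.ad ℂ L (H h₀)).eigenspace (-((n : ℂ) + 1)) := by
  refine Submodule.span_le.2 fun x hx => ?_
  obtain ⟨β, n, hβ, h⟩ := IsWord.exists_weight (-1) hL.hf' h1 hx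
  refine Submodule.mem_iSup_of_mem n ?_
  rw [Module.End.mem_eigenspace_iff, LieAlgebra.ad_apply, h, hβ, neg_one_mul]

theorem range_le_eigenspace (hL : IsChevalley R H e f) (h₀ : 𝔥) :
    LinearMap.range H ≤ (LieAlgebra.ad ℂ L (H h₀)).eigenspace 0 := by
  rintro _ ⟨h, rfl⟩
  rw [Module.End.mem_eigenspace_iff, LieAlgebra.ad_apply, hL.hh, zero_smul]

theorem le_range_sup_iSup_ne (hL : IsChevalley R H e f) {h₀ : 𝔥} (h1 : ∀ i, R.root i h₀ = 1) :
    ⊤ ≤ LinearMap.range H ⊔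
      ⨆ (μ : ℂ) (_ : μ ≠ 0), (LieAlgebra.ad ℂ L (H h₀)).eigenspace μ := by
  rw [← hL.triangular]
  refine sup_le (sup_le ((hL.wordSpan_f_le h1).trans ?_) le_sup_left)
    ((hL.wordSpan_e_le h1).trans ?_)
  · exact iSup_le fun n => le_sup_of_le_right
      (le_iSup₂_of_le _ (neg_ne_zero.2 (Nat.cast_add_one_ne_zero n)) le_rfl)
  · exact iSup_le fun n => le_sup_of_le_right
      (le_iSup₂_of_le _ (Nat.cast_add_one_ne_zero n) le_rfl)

/-- An ideal whose intersection with `𝔥` is trivial lies in the sum of the eigenspaces of nonzero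
eigenvalue of the principal grading. -/
theorem lieIdeal_le (hL : IsChevalley R H e f) {h₀ : 𝔥} (h1 : ∀ i, R.root i h₀ = 1)
    (J : LieIdeal ℂ L) (hJ : ∀ x, H x ∈ J → H x = 0) :
    J.toSubmodule ≤ ⨆ (μ : ℂ) (_ : μ ≠ 0), (LieAlgebra.ad ℂ L (H h₀)).eigenspace μ := by
  intro x hx
  obtain ⟨_, ⟨h, rfl⟩, y, hy, rfl⟩ := Submodule.mem_sup.1
    (hL.le_range_sup_iSup_ne h1 (Submodule.mem_top (x := x)))
  -- In the quotient by `J` the eigenspaces are still independent, so `H h` maps to `0`.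
  let π : L →ₗ[ℂ] L ⧸ J.toSubmodule := J.toSubmodule.mkQ
  let D : Module.End ℂ (L ⧸ J.toSubmodule) :=
    J.toSubmodule.mapQ J.toSubmodule (LieAlgebra.ad ℂ L (H h₀)) fun z hz => J.lie_mem hz
  have hD (μ : ℂ) : ((LieAlgebra.ad ℂ L (H h₀)).eigenspace μ).map π ≤ D.eigenspace μ := by
    rintro _ ⟨z, hz, rfl⟩
    rw [SetLike.mem_coe, Module.End.mem_eigenspace_iff] at hz
    rw [Module.End.mem_eigenspace_iff]
    change π (LieAlgebra.ad ℂ L (H h₀) z) = _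
    rw [hz, map_smul]
  have h0 : π (H h) ∈ D.eigenspace 0 :=
    hD 0 (Submodule.mem_map_of_mem (hL.range_le_eigenspace h₀ ⟨h, rfl⟩))
  have hy' : π y ∈ ⨆ (μ : ℂ) (_ : μ ≠ 0), D.eigenspace μ := by
    have := Submodule.mem_map_of_mem (f := π) hy
    simp only [Submodule.map_iSup] at this
    exact iSup₂_mono (fun μ _ => hD μ) this
  have hsum : π (H h) = -π y := by
    rw [eq_neg_iff_add_eq_zero, ← map_add]
    exact (Submodule.Quotient.mk_eq_zero _).2 hx
  have hz : π (H h) = 0 := Submodule.disjoint_def.1 (disjoint_eigenspace_iSup_ne D 0) _ h0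
    (hsum ▸ neg_mem hy')
  rw [hJ h ((Submodule.Quotient.mk_eq_zero _).1 hz), zero_add]
  exact hy

end IsChevalley

end

/-! ### The embedding of the Cartan subalgebra -/

section

section AuxRep

variable {ι : Type u} [Fintype ι] {C : Matrix ι ι ℤ}
  {𝔥 : Type v} [AddCommGroup 𝔥] [Module ℂ 𝔥] (R : Realization C 𝔥) (lam : Module.Dual ℂ 𝔥)

namespace Realization

/-- The weight `λ - α_{i₁} - ⋯ - α_{iₙ}` of the word `i₁ ⋯ iₙ`. -/
def wordWeight : List ι → Module.Dual ℂ 𝔥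
  | [] => lam
  | i :: l => wordWeight l - R.root i

/-- The operator `f_i` on the free associative algebra with basis the words in `ι`: prefix `i`. -/
def opF (i : ι) : Module.End ℂ (List ι →₀ ℂ) := Finsupp.lmapDomain ℂ ℂ (List.cons i)

/-- The operator `h ∈ 𝔥`: a word is multiplied by the value at `h` of its weight. -/
def opH : 𝔥 →ₗ[ℂ] Module.End ℂ (List ι →₀ ℂ) where
  toFun h := Finsupp.linearCombination ℂ fun l => Finsupp.single l (R.wordWeight lam l h)
  map_add' h k := by ext l : 2; simp
  map_smul' c h := by ext l : 2; simp

open scoped Classical in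
/-- The operator `e_j` on words, defined by `e_j 1 = 0` and
`e_j f_i w = f_i e_j w + δ_{ij} α_i^∨ w`. -/
def opEWord (j : ι) : List ι → (List ι →₀ ℂ)
  | [] => 0
  | i :: l => opF i (opEWord j l) +
      if j = i then Finsupp.single l (R.wordWeight lam l (R.coroot i)) else 0

/-- The operator `e_j`. -/
def opE (j : ι) : Module.End ℂ (List ι →₀ ℂ) := Finsupp.linearCombination ℂ (R.opEWord lam j)

theorem opF_single {κ : Type*} (i : κ) (l : List κ) (c : ℂ) :
    opF i (Finsupp.single l c) = Finsupp.single (i :: l) c := by simp [opF]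

theorem opH_single (h : 𝔥) (l : List ι) :
    R.opH lam h (Finsupp.single l 1) = Finsupp.single l (R.wordWeight lam l h) := by simp [opH]

theorem opE_single (j : ι) (l : List ι) :
    R.opE lam j (Finsupp.single l 1) = R.opEWord lam j l := by simp [opE]

theorem opH_opF (h : 𝔥) (i : ι) :
    R.opH lam h * opF i = opF i * R.opH lam h - R.root i h • opF i := by
  refine Finsupp.lhom_ext' fun l => LinearMap.ext_ring ?_
  change R.opH lam h (opF i (Finsupp.single l 1)) =
    opF i (R.opH lam h (Finsupp.single l 1)) - R.root i h • opF i (Finsupp.single l 1)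
  rw [opF_single, opH_single, opH_single, opF_single, Finsupp.smul_single, ← Finsupp.single_sub]
  simp [wordWeight]

theorem opE_opF (j i : ι) [Decidable (j = i)] : R.opE lam j * opF i =
    opF i * R.opE lam j + if j = i then R.opH lam (R.coroot i) else 0 := by
  refine Finsupp.lhom_ext' fun l => LinearMap.ext_ring ?_
  change R.opE lam j (opF i (Finsupp.single l 1)) = opF i (R.opE lam j (Finsupp.single l 1)) +
    (if j = i then R.opH lam (R.coroot i) else 0 : Module.End ℂ (List ι →₀ ℂ))
      (Finsupp.single l 1)
  rw [opF_single, opE_single, opE_single]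
  by_cases h : j = i
  · rw [if_pos h, opH_single, opEWord, if_pos h]
  · rw [if_neg h, opEWord, if_neg h]; simp

theorem opH_opEWord (h : 𝔥) (j : ι) (l : List ι) : R.opH lam h (R.opEWord lam j l) =
    (R.wordWeight lam l h + R.root j h) • R.opEWord lam j l := by
  induction l with
  | nil => simp [opEWord]
  | cons i l ih =>
    rw [opEWord, map_add, smul_add]
    congr 1
    · have := LinearMap.congr_fun (R.opH_opF lam h i) (R.opEWord lam j l)
      rw [Module.End.mul_apply] at this
      rw [this, LinearMap.sub_apply, Module.End.mul_apply, ih, map_smul, LinearMap.smul_apply,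
        ← sub_smul]
      congr 1
      simp only [wordWeight, LinearMap.sub_apply]
      ring
    · by_cases hij : j = i
      · subst hij
        rw [if_pos rfl, ← mul_one (R.wordWeight lam l (R.coroot j)), ← smul_eq_mul,
          ← Finsupp.smul_single, map_smul, opH_single, Finsupp.smul_single, Finsupp.smul_single,
          Finsupp.smul_single]
        simp [wordWeight, mul_comm]
      · simp [if_neg hij]

theorem opH_opE (h : 𝔥) (j : ι) :
    R.opH lam h * R.opE lam j = R.opE lam j * R.opH lam h + R.root j h • R.opE lam j := by
  refine Finsupp.lhom_ext' fun l => LinearMap.ext_ring ?_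
  change R.opH lam h (R.opE lam j (Finsupp.single l 1)) =
    R.opE lam j (R.opH lam h (Finsupp.single l 1)) + R.root j h • R.opE lam j (Finsupp.single l 1)
  rw [opE_single, opH_opEWord, opH_single, ← mul_one (R.wordWeight lam l h), ← smul_eq_mul,
    ← Finsupp.smul_single, map_smul, opE_single, add_smul, smul_eq_mul, mul_one]

theorem opH_opH (h k : 𝔥) : R.opH lam h * R.opH lam k = R.opH lam k * R.opH lam h := by
  refine Finsupp.lhom_ext' fun l => LinearMap.ext_ring ?_
  simp [opH, mul_comm]

/-- The action of the free Lie algebra on the free associative algebra, with `1` of weight `λ`. -/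
def freeRep : FreeLieAlgebra ℂ (Gen ι 𝔥) →ₗ⁅ℂ⁆ Module.End ℂ (List ι →₀ ℂ) :=
  FreeLieAlgebra.lift ℂ fun g => match g with
    | Gen.H x => R.opH lam x
    | Gen.E i => R.opE lam i
    | Gen.F i => opF i

theorem freeRep_gH (x : 𝔥) : R.freeRep lam (gH ι x) = R.opH lam x :=
  FreeLieAlgebra.lift_of_apply ..

theorem freeRep_gE (i : ι) : R.freeRep lam (gE 𝔥 i) = R.opE lam i :=
  FreeLieAlgebra.lift_of_apply ..

theorem freeRep_gF (i : ι) : R.freeRep lam (gF 𝔥 i) = opF i :=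
  FreeLieAlgebra.lift_of_apply ..

theorem relIdeal_le_ker_freeRep : R.relIdeal ≤ (R.freeRep lam).ker := by
  classical
  refine LieSubmodule.lieSpan_le.2 ?_
  rintro _ ⟨x, y, h, rfl⟩
  rw [SetLike.mem_coe, LieHom.mem_ker, map_sub, sub_eq_zero]
  cases h with
  | add x y => simp only [map_add, freeRep_gH]
  | smul c x => simp only [map_smul, freeRep_gH]
  | hh x y =>
    rw [LieHom.map_lie, freeRep_gH, freeRep_gH, LieRing.of_associative_ring_bracket, opH_opH,
      sub_self, map_zero]
  | he x i =>
    rw [LieHom.map_lie, map_smul, freeRep_gH, freeRep_gE, LieRing.of_associative_ring_bracket,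
      opH_opE]
    abel
  | hf x i =>
    rw [LieHom.map_lie, map_neg, map_smul, freeRep_gH, freeRep_gF,
      LieRing.of_associative_ring_bracket, opH_opF]
    abel
  | ef i =>
    rw [LieHom.map_lie, freeRep_gE, freeRep_gF, freeRep_gH, LieRing.of_associative_ring_bracket,
      opE_opF, if_pos rfl]
    abel
  | ef_ne i j hij =>
    rw [LieHom.map_lie, map_zero, freeRep_gE, freeRep_gF, LieRing.of_associative_ring_bracket,
      opE_opF, if_neg hij]
    abel

/-- `𝔥` embeds into the auxiliary algebra. -/
theorem eq_zero_of_auxH_eq_zero {x : 𝔥} (h : R.auxH x = 0) : x = 0 := by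
  have hx : gH ι x ∈ R.relIdeal := (Submodule.Quotient.mk_eq_zero _).1 h
  rw [← Module.forall_dual_apply_eq_zero_iff ℂ]
  intro lam
  have h1 := R.relIdeal_le_ker_freeRep lam hx
  rw [LieHom.mem_ker, freeRep_gH] at h1
  have h2 := R.opH_single lam x []
  rw [h1] at h2
  simpa [wordWeight] using h2.symm

/-- The quotient map from the free Lie algebra to the auxiliary algebra. -/
def auxProj : FreeLieAlgebra ℂ (Gen ι 𝔥) →ₗ⁅ℂ⁆ R.AuxAlg where
  toFun x := LieSubmodule.Quotient.mk x
  map_add' _ _ := rfl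
  map_smul' _ _ := rfl
  map_lie' := rfl

/-- The quotient map from the free Lie algebra to the Kac–Moody algebra. -/
def projHom : FreeLieAlgebra ℂ (Gen ι 𝔥) →ₗ⁅ℂ⁆ R.Alg where
  toFun := R.proj
  map_add' _ _ := rfl
  map_smul' _ _ := rfl
  map_lie' := rfl

theorem auxProj_eq_of_rel {x y} (h : R.Rel x y) : R.auxProj x = R.auxProj y :=
  (Submodule.Quotient.eq _).2 (LieSubmodule.subset_lieSpan ⟨x, y, h, rfl⟩)

/-- A surjective homomorphism from the free Lie algebra that respects the relations provides
generators as in `IsChevalley`. -/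
theorem isChevalley_of_surjective {L : Type*} [LieRing L] [LieAlgebra ℂ L]
    (π : FreeLieAlgebra ℂ (Gen ι 𝔥) →ₗ⁅ℂ⁆ L) (hπ : Function.Surjective π)
    (hrel : ∀ x y, R.Rel x y → π x = π y) (H : 𝔥 →ₗ[ℂ] L) (hH : ∀ x, H x = π (gH ι x)) :
    IsChevalley R H (fun i => π (gE 𝔥 i)) fun i => π (gF 𝔥 i) where
  hh x y := by rw [hH, hH, ← LieHom.map_lie, hrel _ _ (.hh x y), map_zero]
  he x i := by rw [hH, ← LieHom.map_lie, hrel _ _ (.he x i), map_smul]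
  hf x i := by rw [hH, ← LieHom.map_lie, hrel _ _ (.hf x i), map_neg, map_smul]
  ef i := by rw [hH, ← LieHom.map_lie, hrel _ _ (.ef i)]
  ef_ne i j h := by rw [← LieHom.map_lie, hrel _ _ (.ef_ne i j h), map_zero]
  generates S h1 h2 h3 := by
    let g : Gen ι 𝔥 → S := fun g => match g with
      | Gen.H x => ⟨H x, h1 x⟩
      | Gen.E i => ⟨π (gE 𝔥 i), h2 i⟩
      | Gen.F i => ⟨π (gF 𝔥 i), h3 i⟩
    have hg : S.incl.comp (FreeLieAlgebra.lift ℂ g) = π := by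
      refine FreeLieAlgebra.hom_ext fun x => ?_
      rw [LieHom.comp_apply, FreeLieAlgebra.lift_of_apply]
      cases x with
      | H x => exact hH x
      | E i => rfl
      | F i => rfl
    refine eq_top_iff.2 fun y _ => ?_
    obtain ⟨x, rfl⟩ := hπ y
    rw [← hg]
    exact (FreeLieAlgebra.lift ℂ g x).2

/-- The map `𝔥 → ` auxiliary algebra. -/
def auxHLin : 𝔥 →ₗ[ℂ] R.AuxAlg where
  toFun := R.auxH
  map_add' x y := by
    change R.auxProj _ = R.auxProj _ + R.auxProj _
    rw [← map_add]; exact R.auxProj_eq_of_rel (.add x y)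
  map_smul' c x := by
    change R.auxProj _ = c • R.auxProj _
    rw [← map_smul]; exact R.auxProj_eq_of_rel (.smul c x)

theorem auxAlg_isChevalley : IsChevalley R R.auxHLin (fun i => R.auxProj (gE 𝔥 i))
    fun i => R.auxProj (gF 𝔥 i) :=
  R.isChevalley_of_surjective _ (Submodule.Quotient.mk_surjective _)
    (fun _ _ => R.auxProj_eq_of_rel) _ fun _ => rfl

/-- The generators `e_i` of the Kac–Moody algebra. -/
def genE (i : ι) : R.Alg := R.proj (gE 𝔥 i)

/-- The generators `f_i` of the Kac–Moody algebra. -/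
def genF (i : ι) : R.Alg := R.proj (gF 𝔥 i)

theorem isChevalley : IsChevalley R R.ofH R.genE R.genF :=
  R.isChevalley_of_surjective R.projHom
    ((Submodule.Quotient.mk_surjective R.radical.toSubmodule).comp
      (Submodule.Quotient.mk_surjective R.relIdeal.toSubmodule))
    (fun _ _ => R.proj_eq_of_rel) _ fun _ => rfl

/-- `𝔥` embeds into the Kac–Moody algebra: the ideals that define the radical lie in the sum of
the eigenspaces of nonzero eigenvalue of the principal grading, and hence so does the radical. -/
theorem ofH_injective : Function.Injective R.ofH := by
  obtain ⟨h₀, h1⟩ := R.exists_root_eq_one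
  have hL := R.auxAlg_isChevalley
  rw [← LinearMap.ker_eq_bot, LinearMap.ker_eq_bot']
  intro x hx
  have hx' : R.auxH x ∈ R.radical := (Submodule.Quotient.mk_eq_zero R.radical.toSubmodule).1 hx
  have hle : R.radical.toSubmodule ≤
      ⨆ (μ : ℂ) (_ : μ ≠ 0), (LieAlgebra.ad ℂ R.AuxAlg (R.auxHLin h₀)).eigenspace μ := by
    rw [radical, LieSubmodule.sSup_toSubmodule]
    refine sSup_le ?_
    rintro _ ⟨J, hJ, rfl⟩
    exact hL.lieIdeal_le h1 J hJ
  exact R.eq_zero_of_auxH_eq_zero (Submodule.disjoint_def.1 (disjoint_eigenspace_iSup_ne _ 0) _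
    (hL.range_le_eigenspace h₀ ⟨x, rfl⟩) (hle hx'))

end Realization

end AuxRep

end

/-! ### The derived algebra and the bracket of `𝔤' ⊗ A ⊕ 𝔥''` -/

section

namespace Realization

variable {ι : Type u} [Fintype ι] {C : Matrix ι ι ℤ}
  {𝔥 : Type v} [AddCommGroup 𝔥] [Module ℂ 𝔥] (R : Realization C 𝔥)

section Derived

theorem genE_mem_derived (hC : IsGCM C) (i : ι) : R.genE i ∈ R.derived := by
  have h : R.genE i = (2 : ℂ)⁻¹ • ⁅R.ofH (R.coroot i), R.genE i⁆ := by
    rw [R.isChevalley.he, R.root_coroot, hC.diag]; simp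
  rw [h]
  exact R.derived.smul_mem _ (LieSubmodule.lie_mem_lie (LieSubmodule.mem_top _)
    (LieSubmodule.mem_top _))

theorem genF_mem_derived (hC : IsGCM C) (i : ι) : R.genF i ∈ R.derived := by
  have h : R.genF i = -((2 : ℂ)⁻¹ • ⁅R.ofH (R.coroot i), R.genF i⁆) := by
    rw [R.isChevalley.hf, R.root_coroot, hC.diag]; simp
  rw [h]
  exact neg_mem (R.derived.smul_mem _ (LieSubmodule.lie_mem_lie (LieSubmodule.mem_top _)
    (LieSubmodule.mem_top _)))

theorem coroot_mem_cartanDerived (i : ι) : R.coroot i ∈ R.cartanDerived := by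
  change R.ofH (R.coroot i) ∈ R.derived
  rw [← R.isChevalley.ef]
  exact LieSubmodule.lie_mem_lie (LieSubmodule.mem_top _) (LieSubmodule.mem_top _)

/-- `e_i` as an element of the derived algebra. -/
def derE (hC : IsGCM C) (i : ι) : R.derived := ⟨R.genE i, R.genE_mem_derived hC i⟩

/-- `f_i` as an element of the derived algebra. -/
def derF (hC : IsGCM C) (i : ι) : R.derived := ⟨R.genF i, R.genF_mem_derived hC i⟩

/-- `α_i^∨` as an element of `𝔥'`. -/
def derCoroot (i : ι) : R.cartanDerived := ⟨R.coroot i, R.coroot_mem_cartanDerived i⟩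

theorem derE_lie_derF (hC : IsGCM C) (i j : ι) [Decidable (i = j)] :
    ⁅R.derE hC i, R.derF hC j⁆ = if i = j then R.cartanIncl (R.derCoroot i) else 0 := by
  ext
  change ⁅R.genE i, R.genF j⁆ = _
  split_ifs with h
  · subst h; exact R.isChevalley.ef i
  · exact R.isChevalley.ef_ne i j h

theorem isWord_coe {e : ι → R.derived} {x : R.derived} (h : IsWord e x) :
    IsWord (fun i => (e i : R.Alg)) (x : R.Alg) := by
  induction h with
  | base i => exact IsWord.base (e := fun i => (e i : R.Alg)) i
  | step i _ ih => exact IsWord.step (e := fun i => (e i : R.Alg)) i ih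

theorem wordSpan_coe_le (e : ι → R.derived) :
    wordSpan (fun i => (e i : R.Alg)) ≤ (wordSpan e).map R.derived.toSubmodule.subtype := by
  refine Submodule.span_le.2 fun x hx => ?_
  suffices h : ∃ y, IsWord e y ∧ (y : R.Alg) = x by
    obtain ⟨y, hy, rfl⟩ := h
    exact ⟨y, hy.mem_wordSpan, rfl⟩
  induction hx with
  | base i => exact ⟨e i, .base i, rfl⟩
  | step i _ ih =>
    obtain ⟨y, hy, rfl⟩ := ih
    exact ⟨⁅e i, y⁆, .step i hy, rfl⟩

/-- The triangular decomposition of the derived algebra. -/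
theorem derived_triangular (hC : IsGCM C) :
    wordSpan (R.derF hC) ⊔ LinearMap.range R.cartanIncl ⊔ wordSpan (R.derE hC) = ⊤ := by
  refine eq_top_iff.2 fun x _ => ?_
  obtain ⟨y, hy, z, hz, hyz⟩ := Submodule.mem_sup.1
    (R.isChevalley.triangular.ge (Submodule.mem_top (x := (x : R.Alg))))
  obtain ⟨a, ha, _, ⟨h, rfl⟩, rfl⟩ := Submodule.mem_sup.1 hy
  obtain ⟨a', ha', rfl⟩ := R.wordSpan_coe_le (R.derF hC) ha
  obtain ⟨z', hz', rfl⟩ := R.wordSpan_coe_le (R.derE hC) hz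
  have hh : h ∈ R.cartanDerived := by
    change R.ofH h ∈ R.derived
    have : R.ofH h = ((x - a' - z' : R.derived) : R.Alg) := by
      change R.ofH h = (x : R.Alg) - (a' : R.Alg) - (z' : R.Alg)
      rw [← hyz]
      change _ = (a' : R.Alg) + R.ofH h + (z' : R.Alg) - (a' : R.Alg) - (z' : R.Alg)
      abel
    rw [this]; exact (x - a' - z').2
  refine Submodule.mem_sup.2 ⟨a' + R.cartanIncl ⟨h, hh⟩,
    Submodule.add_mem_sup ha' ⟨_, rfl⟩, z', hz', ?_⟩
  ext
  exact hyz

theorem adH_derE_word (hC : IsGCM C) {h₀ : 𝔥} (h1 : ∀ i, R.root i h₀ = 1) {x : R.derived}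
    (hx : IsWord (R.derE hC) x) : ∃ (β : Module.Dual ℂ 𝔥) (n : ℕ), β h₀ = n + 1 ∧
      ∀ h, R.adH h x = β h • x := by
  obtain ⟨β, n, hβ, h⟩ := IsWord.exists_weight 1 R.isChevalley.he' h1 (R.isWord_coe hx)
  exact ⟨β, n, hβ, fun k => Subtype.ext ((h k).trans (by simp))⟩

theorem adH_derF_word (hC : IsGCM C) {h₀ : 𝔥} (h1 : ∀ i, R.root i h₀ = 1) {x : R.derived}
    (hx : IsWord (R.derF hC) x) : ∃ (β : Module.Dual ℂ 𝔥) (n : ℕ), β h₀ = n + 1 ∧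
      ∀ h, R.adH h x = -(β h) • x := by
  obtain ⟨β, n, hβ, h⟩ := IsWord.exists_weight (-1) R.isChevalley.hf' h1 (R.isWord_coe hx)
  exact ⟨β, n, hβ, fun k => Subtype.ext ((h k).trans (by simp))⟩

theorem cartanIncl_injective : Function.Injective R.cartanIncl := by
  intro x y h
  exact Subtype.ext (R.ofH_injective (congrArg Subtype.val h))

theorem cartanIncl_lie (x : R.cartanDerived) (z : R.derived) :
    ⁅R.cartanIncl x, z⁆ = R.adH x z := rfl

theorem adH_cartanIncl (h : 𝔥) (x : R.cartanDerived) : R.adH h (R.cartanIncl x) = 0 :=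
  Subtype.ext (R.ofH_lie_ofH h x)

theorem adH_add (h k : 𝔥) (z : R.derived) : R.adH (h + k) z = R.adH h z + R.adH k z := by
  ext; simp [adH]

end Derived

section Current

variable (A : Type w) [CommRing A] [Algebra ℂ A] (𝔥'' : Submodule ℂ 𝔥)

/-- `X ⊗ a`, as an element of `𝔤' ⊗ A ⊕ 𝔥''`. -/
def tens (a : A) (x : R.derived) : R.Cur A 𝔥'' := Cur.mk R A 𝔥'' (a ⊗ₜ x) 0

/-- The inclusion of `𝔥' ⊗ A ⊕ 𝔥''` into `𝔤' ⊗ A ⊕ 𝔥''`. -/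
def curH : R.CurH A 𝔥'' →ₗ[ℂ] R.Cur A 𝔥'' :=
  LinearMap.prodMap (R.cartanIncl.lTensor A) LinearMap.id

theorem uTensor_eq (a : A) (x : R.derived) :
    R.uTensor A 𝔥'' a x = UniversalEnvelopingAlgebra.ι ℂ (R.tens A 𝔥'' a x) := rfl

theorem uCartan_eq (h : R.CurH A 𝔥'') :
    R.uCartan A 𝔥'' h = UniversalEnvelopingAlgebra.ι ℂ (R.curH A 𝔥'' h) := rfl

theorem mk_lie_mk (t t' : A ⊗[ℂ] R.derived) (y y' : 𝔥'') :
    ⁅Cur.mk R A 𝔥'' t y, Cur.mk R A 𝔥'' t' y'⁆ =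
      Cur.mk R A 𝔥'' (⁅t, t'⁆ + R.actH A y t' - R.actH A y' t) 0 := rfl

/-- `X ↦ X ⊗ a` as a bilinear map. -/
def tensLin : A →ₗ[ℂ] R.derived →ₗ[ℂ] R.Cur A 𝔥'' :=
  (TensorProduct.mk ℂ A R.derived).compr₂ (LinearMap.inl ℂ (A ⊗[ℂ] R.derived) 𝔥'')

theorem tensLin_apply (a : A) (x : R.derived) : R.tensLin A 𝔥'' a x = R.tens A 𝔥'' a x := rfl

theorem actH_zero (t : A ⊗[ℂ] R.derived) : R.actH A 0 t = 0 := by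
  have := R.actH_smul A 0 0 t
  simpa using this

theorem tens_lie_tens (a b : A) (x y : R.derived) :
    ⁅R.tens A 𝔥'' a x, R.tens A 𝔥'' b y⁆ = R.tens A 𝔥'' (a * b) ⁅x, y⁆ := by
  rw [tens, tens, mk_lie_mk, Submodule.coe_zero, actH_zero, actH_zero,
    LieAlgebra.ExtendScalars.bracket_tmul, add_zero, sub_zero]
  rfl

theorem curH_lie_tens_of_right (y : 𝔥'') (b : A) (x : R.derived) :
    ⁅R.curH A 𝔥'' (0, y), R.tens A 𝔥'' b x⁆ = R.tens A 𝔥'' b (R.adH y x) := by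
  change ⁅Cur.mk R A 𝔥'' (R.cartanIncl.lTensor A 0) y, _⁆ = _
  rw [tens, mk_lie_mk, Submodule.coe_zero, actH_zero, map_zero, zero_lie, zero_add, sub_zero,
    actH_tmul]
  rfl

theorem curH_tmul (a : A) (x : R.cartanDerived) :
    R.curH A 𝔥'' (a ⊗ₜ x, 0) = R.tens A 𝔥'' a (R.cartanIncl x) := rfl

theorem curH_hEmb_lie_tens (x : R.cartanDerived) (y : 𝔥'') (b : A) (z : R.derived) :
    ⁅R.curH A 𝔥'' (R.hEmb A 𝔥'' x y), R.tens A 𝔥'' b z⁆ =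
      R.tens A 𝔥'' b (R.adH ((x : 𝔥) + y) z) := by
  have : R.hEmb A 𝔥'' x y = ((1 : A) ⊗ₜ x, 0) + (0, y) := by simp [hEmb]
  rw [this, map_add, add_lie, curH_lie_tens_of_right, curH_tmul, tens_lie_tens, one_mul,
    cartanIncl_lie, adH_add, ← tensLin_apply, ← tensLin_apply, ← tensLin_apply, map_add]

/-- A subspace of `𝔥' ⊗ A ⊕ 𝔥''` that contains the `X ⊗ a` and `𝔥''` is everything. -/
theorem curH_eq_top {S : Submodule ℂ (R.CurH A 𝔥'')} (h1 : ∀ a x, (a ⊗ₜ x, 0) ∈ S)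
    (h2 : ∀ y, (0, y) ∈ S) : S = ⊤ := by
  refine eq_top_iff.2 fun z _ => ?_
  have hz : z = (z.1, 0) + (0, z.2) := by simp
  rw [hz]
  refine add_mem ?_ (h2 _)
  induction z.1 with
  | zero => exact zero_mem _
  | add a b ha hb => simpa using add_mem ha hb
  | tmul a x => exact h1 a x

/-- A subspace of `𝔤' ⊗ A ⊕ 𝔥''` that contains the `X ⊗ a` for `X ∈ 𝔥'` and for `X` a bracket of
the `f_i` or of the `e_i`, and that contains `𝔥''`, is everything. -/
theorem cur_eq_top (hC : IsGCM C) {S : Submodule ℂ (R.Cur A 𝔥'')}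
    (hF : ∀ a x, IsWord (R.derF hC) x → R.tens A 𝔥'' a x ∈ S)
    (hH : LinearMap.range (R.curH A 𝔥'') ≤ S)
    (hE : ∀ a x, IsWord (R.derE hC) x → R.tens A 𝔥'' a x ∈ S) : S = ⊤ := by
  have key (a : A) (x : R.derived) : R.tens A 𝔥'' a x ∈ S := by
    have : (⊤ : Submodule ℂ R.derived) ≤ S.comap (R.tensLin A 𝔥'' a) := by
      rw [← R.derived_triangular hC]
      refine sup_le (sup_le (Submodule.span_le.2 fun x hx => hF a x hx) ?_)
        (Submodule.span_le.2 fun x hx => hE a x hx)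
      rintro _ ⟨h, rfl⟩
      exact hH ⟨(a ⊗ₜ h, 0), R.curH_tmul A 𝔥'' a h⟩
    exact this (Submodule.mem_top (x := x))
  refine eq_top_iff.2 fun z _ => ?_
  have hz : z = Cur.mk R A 𝔥'' z.1 0 + R.curH A 𝔥'' (0, z.2) := by
    refine Prod.ext ?_ ?_
    · change z.1 = z.1 + R.cartanIncl.lTensor A 0
      rw [map_zero, add_zero]
    · change z.2 = 0 + z.2
      rw [zero_add]
  rw [hz]
  refine add_mem ?_ (hH ⟨_, rfl⟩)
  induction z.1 with
  | zero => exact zero_mem _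
  | add a b ha hb =>
    have : Cur.mk R A 𝔥'' (a + b) 0 = Cur.mk R A 𝔥'' a 0 + Cur.mk R A 𝔥'' b 0 :=
      Prod.ext rfl (zero_add (0 : 𝔥'')).symm
    rw [this]; exact add_mem ha hb
  | tmul a x => exact key a x

theorem curH_lie_curH (h k : R.CurH A 𝔥'') : ⁅R.curH A 𝔥'' h, R.curH A 𝔥'' k⁆ = 0 := by
  have h1 (a : A) (x : R.cartanDerived) (k : R.CurH A 𝔥'') :
      ⁅R.curH A 𝔥'' k, R.tens A 𝔥'' a (R.cartanIncl x)⁆ = 0 := by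
    have := R.curH_eq_top A 𝔥'' (S := LinearMap.ker
      (((LieAlgebra.ad ℂ (R.Cur A 𝔥'')).toLinearMap.flip
        (R.tens A 𝔥'' a (R.cartanIncl x))).comp (R.curH A 𝔥'')))
      (fun b y => by
        change ⁅R.curH A 𝔥'' (b ⊗ₜ y, 0), R.tens A 𝔥'' a (R.cartanIncl x)⁆ = 0
        rw [curH_tmul, tens_lie_tens, cartanIncl_lie, adH_cartanIncl, ← tensLin_apply, map_zero])
      (fun y => by
        change ⁅R.curH A 𝔥'' (0, y), R.tens A 𝔥'' a (R.cartanIncl x)⁆ = 0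
        rw [curH_lie_tens_of_right, adH_cartanIncl, ← tensLin_apply, map_zero])
    exact this.ge (Submodule.mem_top (x := k))
  have := R.curH_eq_top A 𝔥'' (S := LinearMap.ker
      ((LieAlgebra.ad ℂ (R.Cur A 𝔥'') (R.curH A 𝔥'' h)).comp (R.curH A 𝔥'')))
      (fun a x => h1 a x h)
      (fun y => by
        change ⁅R.curH A 𝔥'' h, R.curH A 𝔥'' (0, y)⁆ = 0
        have := R.curH_eq_top A 𝔥'' (S := LinearMap.ker
          (((LieAlgebra.ad ℂ (R.Cur A 𝔥'')).toLinearMap.flip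
            (R.curH A 𝔥'' (0, y))).comp (R.curH A 𝔥'')))
          (fun b x => by
            change ⁅R.curH A 𝔥'' (b ⊗ₜ x, 0), R.curH A 𝔥'' (0, y)⁆ = 0
            rw [curH_tmul, ← lie_skew, h1, neg_zero])
          (fun y' => by
            change ⁅R.curH A 𝔥'' (0, y'), R.curH A 𝔥'' (0, y)⁆ = 0
            change ⁅Cur.mk R A 𝔥'' (R.cartanIncl.lTensor A 0) y',
              Cur.mk R A 𝔥'' (R.cartanIncl.lTensor A 0) y⁆ = 0
            rw [mk_lie_mk]
            simp only [map_zero, lie_zero, add_zero, sub_zero]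
            rfl)
        exact this.ge (Submodule.mem_top (x := h)))
  exact this.ge (Submodule.mem_top (x := k))

theorem curH_injective : Function.Injective (R.curH A 𝔥'') := by
  have h := Module.Flat.lTensor_preserves_injective_linearMap (M := A) R.cartanIncl
    R.cartanIncl_injective
  exact Function.Injective.prodMap h Function.injective_id

end Current

end Realization

end

/-! ### The generator is nonzero in the quotient of the Verma module -/

section

namespace Realization

variable {ι : Type u} [Fintype ι] {C : Matrix ι ι ℤ}
  {𝔥 : Type v} [AddCommGroup 𝔥] [Module ℂ 𝔥] (R : Realization C 𝔥)

theorem exists_apply_eq_of_mem_posRoots {h₀ : 𝔥} (h1 : ∀ i, R.root i h₀ = 1)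
    {β : Module.Dual ℂ 𝔥} (hβ : β ∈ R.posRoots) : ∃ n : ℕ, β h₀ = n + 1 := by
  have key : ∀ β ∈ R.posCone, β = 0 ∨ ∃ n : ℕ, β h₀ = n + 1 := by
    intro β hβ
    induction hβ using AddSubmonoid.closure_induction with
    | mem x hx =>
      obtain ⟨i, rfl⟩ := hx
      exact .inr ⟨0, by simp [h1]⟩
    | zero => exact .inl rfl
    | add x y _ _ hx hy =>
      rcases hx with rfl | ⟨m, hm⟩
      · rwa [zero_add]
      · rcases hy with rfl | ⟨n, hn⟩
        · rw [add_zero]; exact .inr ⟨m, hm⟩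
        · exact .inr ⟨m + n + 1, by rw [LinearMap.add_apply, hm, hn]; push_cast; ring⟩
  exact (key β hβ.1).resolve_left hβ.2.1

section Action

variable (B : Type w) [CommRing B] [Algebra ℂ B] (𝔥'' : Submodule ℂ 𝔥)

theorem tens_mem_eigenspace {x₀ : R.cartanDerived} {y₀ : 𝔥''} {μ : ℂ} {x : R.derived}
    (hx : R.adH ((x₀ : 𝔥) + y₀) x = μ • x) (b : B) : R.tens B 𝔥'' b x ∈
      (LieAlgebra.ad ℂ (R.Cur B 𝔥'') (R.curH B 𝔥'' (R.hEmb B 𝔥'' x₀ y₀))).eigenspace μ := by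
  rw [Module.End.mem_eigenspace_iff, LieAlgebra.ad_apply, curH_hEmb_lie_tens, hx,
    ← tensLin_apply, ← tensLin_apply, map_smul]

/-- Every linear form `ψ` on `𝔥' ⊗ B ⊕ 𝔥''` is the highest weight of a module: there is an action
of `𝔤' ⊗ B ⊕ 𝔥''` with a nonzero vector on which `𝔥' ⊗ B ⊕ 𝔥''` acts by `ψ` and which is killed
by the elements of positive degree for the principal grading. -/
theorem exists_action_of_dual (hC : IsGCM C) (x₀ : R.cartanDerived) (y₀ : 𝔥'')
    (h1 : ∀ i, R.root i ((x₀ : 𝔥) + y₀) = 1) (ψ : Module.Dual ℂ (R.CurH B 𝔥'')) :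
    ∃ (W : Type (max u v w)) (_ : AddCommGroup W) (_ : Module ℂ W)
      (ρ : R.Cur B 𝔥'' →ₗ⁅ℂ⁆ Module.End ℂ W) (w : W), w ≠ 0 ∧
      (∀ h, ρ (R.curH B 𝔥'' h) w = ψ h • w) ∧
      ∀ (b : B) (x : R.derived) (n : ℕ), R.adH ((x₀ : 𝔥) + y₀) x = ((n : ℂ) + 1) • x →
        ρ (R.tens B 𝔥'' b x) w = 0 := by
  set z := R.curH B 𝔥'' (R.hEmb B 𝔥'' x₀ y₀) with hz
  have hF (b : B) (x : R.derived) (hx : IsWord (R.derF hC) x) : ∃ n : ℕ,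
      R.tens B 𝔥'' b x ∈ (LieAlgebra.ad ℂ (R.Cur B 𝔥'') z).eigenspace (-((n : ℂ) + 1)) := by
    obtain ⟨β, n, hβ, h⟩ := R.adH_derF_word hC h1 hx
    exact ⟨n, R.tens_mem_eigenspace B 𝔥'' (by rw [h, hβ]) b⟩
  have hE (b : B) (x : R.derived) (hx : IsWord (R.derE hC) x) : ∃ n : ℕ,
      R.tens B 𝔥'' b x ∈ (LieAlgebra.ad ℂ (R.Cur B 𝔥'') z).eigenspace ((n : ℂ) + 1) := by
    obtain ⟨β, n, hβ, h⟩ := R.adH_derE_word hC h1 hx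
    exact ⟨n, R.tens_mem_eigenspace B 𝔥'' (by rw [h, hβ]) b⟩
  have hH : LinearMap.range (R.curH B 𝔥'') ≤
      (LieAlgebra.ad ℂ (R.Cur B 𝔥'') z).eigenspace 0 := by
    rintro _ ⟨h, rfl⟩
    rw [Module.End.mem_eigenspace_iff, LieAlgebra.ad_apply, hz, curH_lie_curH, zero_smul]
  have htop : ⨆ k : ℤ, (LieAlgebra.ad ℂ (R.Cur B 𝔥'') z).eigenspace (k : ℂ) = ⊤ := by
    refine R.cur_eq_top B 𝔥'' hC (fun a x hx => ?_) ?_ fun a x hx => ?_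
    · obtain ⟨n, hn⟩ := hF a x hx
      refine Submodule.mem_iSup_of_mem (-((n : ℤ) + 1)) ?_
      push_cast; exact hn
    · refine hH.trans (le_iSup_of_le 0 ?_)
      push_cast; exact le_rfl
    · obtain ⟨n, hn⟩ := hE a x hx
      refine Submodule.mem_iSup_of_mem ((n : ℤ) + 1) ?_
      push_cast; exact hn
  set N : Submodule ℂ (R.Cur B 𝔥'') :=
    ⨆ (μ : ℂ) (_ : μ ≠ 0), (LieAlgebra.ad ℂ (R.Cur B 𝔥'') z).eigenspace μ with hN
  have hsup : LinearMap.range (R.curH B 𝔥'') ⊔ N = ⊤ := by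
    refine R.cur_eq_top B 𝔥'' hC (fun a x hx => ?_) le_sup_left fun a x hx => ?_
    · obtain ⟨n, hn⟩ := hF a x hx
      exact Submodule.mem_sup_right (Submodule.mem_iSup_of_mem _
        (Submodule.mem_iSup_of_mem (neg_ne_zero.2 (Nat.cast_add_one_ne_zero n)) hn))
    · obtain ⟨n, hn⟩ := hE a x hx
      exact Submodule.mem_sup_right (Submodule.mem_iSup_of_mem _
        (Submodule.mem_iSup_of_mem (Nat.cast_add_one_ne_zero n) hn))
  have hc : IsCompl (LinearMap.range (R.curH B 𝔥'')) N :=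
    ⟨(disjoint_eigenspace_iSup_ne _ 0).mono_left hH, codisjoint_iff.2 hsup⟩
  have h0 := eigenspace_le_of_le_sup _ _ _ hH hsup.ge
  -- `ψ`, extended by zero to the elements of nonzero degree.
  let χ : R.Cur B 𝔥'' →ₗ[ℂ] ℂ := ψ ∘ₗ
    ((LinearEquiv.ofInjective _ (R.curH_injective B 𝔥'')).symm : _ →ₗ[ℂ] _) ∘ₗ
    Submodule.projectionOnto _ N hc
  have hχH (h : R.CurH B 𝔥'') : χ (R.curH B 𝔥'' h) = ψ h := by
    have : Submodule.projectionOnto _ N hc (R.curH B 𝔥'' h) =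
        LinearEquiv.ofInjective _ (R.curH_injective B 𝔥'') h :=
      Submodule.projectionOnto_apply_left hc ⟨_, h, rfl⟩
    simp only [χ, LinearMap.comp_apply, this]
    simp
  have hχN (μ : ℂ) (hμ : μ ≠ 0) (x) (hx : x ∈ (LieAlgebra.ad ℂ (R.Cur B 𝔥'') z).eigenspace μ) :
      χ x = 0 := by
    have hxN : x ∈ N := Submodule.mem_iSup_of_mem _ (Submodule.mem_iSup_of_mem hμ hx)
    have : Submodule.projectionOnto _ N hc x = 0 :=
      Submodule.projectionOnto_apply_right hc ⟨x, hxN⟩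
    simp only [χ, LinearMap.comp_apply, this, map_zero]
  obtain ⟨W, i1, i2, ρ, w, hw, hρ⟩ := exists_highestWeight_action z htop χ (by
    intro x hx y hy
    obtain ⟨h, rfl⟩ := h0 hx
    obtain ⟨k, rfl⟩ := h0 hy
    rw [curH_lie_curH, map_zero]) hχN
  refine ⟨W, i1, i2, ρ, w, hw, fun h => ?_, fun b x n hx => ?_⟩
  · rw [← hχH]
    refine hρ 0 _ ?_
    rw [Nat.cast_zero]
    exact hH ⟨h, rfl⟩
  · have hx' := R.tens_mem_eigenspace B 𝔥'' hx b
    rw [hρ (n + 1) _ (by push_cast; exact hx'), hχN _ (Nat.cast_add_one_ne_zero n) _ hx',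
      zero_smul]

end Action

section Quotient

variable {A : Type w} [CommRing A] [Algebra ℂ A] (𝔥'' : Submodule ℂ 𝔥)
  {B : Type w} [CommRing B] [Algebra ℂ B] (φ : A →ₐ[ℂ] B)

theorem actH_rTensor (h : 𝔥) (t : A ⊗[ℂ] R.derived) : R.actH B h
    (φ.toLinearMap.rTensor R.derived t) = φ.toLinearMap.rTensor R.derived (R.actH A h t) := by
  induction t with
  | zero => simp
  | add x y hx hy => simp only [map_add, hx, hy]
  | tmul a x => rfl

theorem lie_rTensor (t t' : A ⊗[ℂ] R.derived) :
    φ.toLinearMap.rTensor R.derived ⁅t, t'⁆ =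
      ⁅φ.toLinearMap.rTensor R.derived t, φ.toLinearMap.rTensor R.derived t'⁆ := by
  induction t with
  | zero => simp
  | add x y hx hy => simp only [add_lie, map_add, hx, hy]
  | tmul a x =>
    induction t' with
    | zero => simp
    | add x y hx hy => simp only [lie_add, map_add, hx, hy]
    | tmul b y => simp [LieAlgebra.ExtendScalars.bracket_tmul]

/-- The homomorphism `𝔤' ⊗ A ⊕ 𝔥'' → 𝔤' ⊗ B ⊕ 𝔥''` given by an algebra homomorphism `A → B`. -/
def curMap : R.Cur A 𝔥'' →ₗ⁅ℂ⁆ R.Cur B 𝔥'' :=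
  { LinearMap.prodMap (φ.toLinearMap.rTensor R.derived) (LinearMap.id : 𝔥'' →ₗ[ℂ] 𝔥'') with
    map_lie' := by
      rintro ⟨t, y⟩ ⟨t', y'⟩
      change Cur.mk R B 𝔥'' (φ.toLinearMap.rTensor R.derived
          (⁅t, t'⁆ + R.actH A y t' - R.actH A y' t)) 0 =
        ⁅Cur.mk R B 𝔥'' (φ.toLinearMap.rTensor R.derived t) y,
          Cur.mk R B 𝔥'' (φ.toLinearMap.rTensor R.derived t') y'⁆
      rw [mk_lie_mk, actH_rTensor, actH_rTensor, ← lie_rTensor, map_sub, map_add] }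

theorem curMap_tens (a : A) (x : R.derived) :
    R.curMap 𝔥'' φ (R.tens A 𝔥'' a x) = R.tens B 𝔥'' (φ a) x := rfl

theorem curMap_curH (h : R.CurH A 𝔥'') : R.curMap 𝔥'' φ (R.curH A 𝔥'' h) =
    R.curH B 𝔥'' (φ.toLinearMap.rTensor R.cartanDerived h.1, h.2) := by
  refine Prod.ext ?_ rfl
  change φ.toLinearMap.rTensor R.derived (R.cartanIncl.lTensor A h.1) =
    R.cartanIncl.lTensor B (φ.toLinearMap.rTensor R.cartanDerived h.1)
  rw [← LinearMap.comp_apply, ← LinearMap.comp_apply, LinearMap.rTensor_comp_lTensor,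
    LinearMap.lTensor_comp_rTensor]

/-- A linear form on `𝔥' ⊗ A ⊕ 𝔥''` that vanishes on `𝔥' ⊗ I` comes from `𝔥' ⊗ A/I ⊕ 𝔥''`. -/
theorem exists_dual_quotient (I : Ideal A) (ψ : Module.Dual ℂ (R.CurH A 𝔥''))
    (hψI : ∀ a ∈ I, ∀ x : R.cartanDerived, ψ (a ⊗ₜ[ℂ] x, 0) = 0) :
    ∃ ψ' : Module.Dual ℂ (R.CurH (A ⧸ I) 𝔥''), ∀ h, ψ'
      ((Ideal.Quotient.mkₐ ℂ I).toLinearMap.rTensor R.cartanDerived h.1, h.2) = ψ h := by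
  obtain ⟨s, hs⟩ := (Ideal.Quotient.mkₐ ℂ I).toLinearMap.exists_rightInverse_of_surjective
    (LinearMap.range_eq_top.2 (Ideal.Quotient.mkₐ_surjective ℂ I))
  let T : R.CurH (A ⧸ I) 𝔥'' →ₗ[ℂ] R.CurH A 𝔥'' :=
    LinearMap.prodMap (s.rTensor R.cartanDerived) LinearMap.id
  let P : R.CurH A 𝔥'' →ₗ[ℂ] R.CurH (A ⧸ I) 𝔥'' :=
    LinearMap.prodMap ((Ideal.Quotient.mkₐ ℂ I).toLinearMap.rTensor R.cartanDerived)
      LinearMap.id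
  refine ⟨ψ ∘ₗ T, fun h => ?_⟩
  have := R.curH_eq_top A 𝔥'' (S := LinearMap.eqLocus (ψ ∘ₗ T ∘ₗ P) ψ)
    (fun a x => by
      rw [LinearMap.mem_eqLocus]
      change ψ (s (Ideal.Quotient.mk I a) ⊗ₜ x, 0) = ψ (a ⊗ₜ x, 0)
      have ha : s (Ideal.Quotient.mk I a) - a ∈ I := by
        rw [← Ideal.Quotient.eq_zero_iff_mem, map_sub, sub_eq_zero]
        exact LinearMap.congr_fun hs (Ideal.Quotient.mk I a)
      rw [← sub_eq_zero, ← map_sub, Prod.mk_sub_mk, ← TensorProduct.sub_tmul, sub_zero]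
      exact hψI _ ha x)
    (fun y => by
      rw [LinearMap.mem_eqLocus]
      change ψ (s.rTensor R.cartanDerived ((Ideal.Quotient.mkₐ ℂ I).toLinearMap.rTensor
        R.cartanDerived 0), y) = _
      rw [map_zero, map_zero])
  exact this.ge (Submodule.mem_top (x := h))

/-- The generator of the Verma module does not lie in the submodule generated by the
`(X ⊗ a) v`: there is a module in which a nonzero vector satisfies all these relations, pulled
back from `𝔤' ⊗ A/I ⊕ 𝔥''`, where the `X ⊗ a` with `a ∈ I` act by zero. -/
theorem vermaVec_notMem_relSubmodule (hC : IsGCM C) (h_compl : IsCompl R.cartanDerived 𝔥'')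
    (I : Ideal A) (J : R.posRoots → Ideal A) (hJ : ∀ β, J β ≤ I)
    (ψ : Module.Dual ℂ (R.CurH A 𝔥''))
    (hψI : ∀ a ∈ I, ∀ x : R.cartanDerived, ψ (a ⊗ₜ[ℂ] x, 0) = 0) :
    R.vermaVec ψ ∉ R.relSubmodule ψ J := by
  obtain ⟨h₀, h1⟩ := R.exists_root_eq_one
  obtain ⟨x₀, hx₀, y₀, hy₀, rfl⟩ := Submodule.mem_sup.1
    (h_compl.sup_eq_top.ge (Submodule.mem_top (x := h₀)))
  obtain ⟨ψ', hψ'⟩ := R.exists_dual_quotient 𝔥'' I ψ hψI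
  obtain ⟨W, _, _, ρ, w, hw, hρH, hρE⟩ :=
    R.exists_action_of_dual (A ⧸ I) 𝔥'' hC ⟨x₀, hx₀⟩ ⟨y₀, hy₀⟩ h1 ψ'
  let Φ : R.U A 𝔥'' →ₐ[ℂ] Module.End ℂ W :=
    UniversalEnvelopingAlgebra.lift ℂ (ρ.comp (R.curMap 𝔥'' (Ideal.Quotient.mkₐ ℂ I)))
  have hΦ (x : R.Cur A 𝔥'') : Φ (UniversalEnvelopingAlgebra.ι ℂ x) =
      ρ (R.curMap 𝔥'' (Ideal.Quotient.mkₐ ℂ I) x) := UniversalEnvelopingAlgebra.lift_ι_apply ..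
  let Ann : Submodule (R.U A 𝔥'') (R.U A 𝔥'') :=
    { carrier := {u | Φ u w = 0}
      zero_mem' := by simp
      add_mem' := fun {a b} ha hb => by
        change Φ (a + b) w = 0
        rw [map_add, LinearMap.add_apply, ha, hb, add_zero]
      smul_mem' := fun c u hu => by
        change Φ (c * u) w = 0
        rw [map_mul, Module.End.mul_apply, hu, map_zero] }
  have hle : R.vermaIdeal ψ ≤ Ann := by
    refine Submodule.span_le.2 ?_
    rintro _ (⟨β, hβ, x, hx, a, rfl⟩ | ⟨h, rfl⟩)
    · change Φ (R.uTensor A 𝔥'' a x) w = 0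
      obtain ⟨n, hn⟩ := R.exists_apply_eq_of_mem_posRoots h1 hβ
      rw [uTensor_eq, hΦ, curMap_tens]
      refine hρE _ _ n (Subtype.ext ?_)
      rw [← hn]
      exact hx _
    · change Φ (R.uCartan A 𝔥'' h - algebraMap ℂ (R.U A 𝔥'') (ψ h)) w = 0
      rw [uCartan_eq, map_sub, LinearMap.sub_apply, hΦ, curMap_curH, hρH, hψ',
        AlgHom.commutes, Module.algebraMap_end_apply, sub_self]
  have hle2 : R.relSubmodule ψ J ≤ Ann.map (R.vermaIdeal ψ).mkQ := by
    refine Submodule.span_le.2 ?_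
    rintro _ ⟨β, x, -, a, ha, rfl⟩
    refine ⟨R.uTensor A 𝔥'' a x, ?_, ?_⟩
    · change Φ (R.uTensor A 𝔥'' a x) w = 0
      have ha0 : Ideal.Quotient.mkₐ ℂ I a = 0 := Ideal.Quotient.eq_zero_iff_mem.2 (hJ β ha)
      rw [uTensor_eq, hΦ, curMap_tens, ha0, ← tensLin_apply, map_zero, LinearMap.zero_apply,
        map_zero, LinearMap.zero_apply]
    · change Submodule.Quotient.mk _ = R.uTensor A 𝔥'' a x • Submodule.Quotient.mk 1
      rw [← Submodule.Quotient.mk_smul, smul_eq_mul, mul_one]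
  intro hmem
  obtain ⟨u, hu, huv⟩ := hle2 hmem
  have h2 : u - 1 ∈ R.vermaIdeal ψ := (Submodule.Quotient.eq _).1 huv
  have h3 : (1 : R.U A 𝔥'') ∈ Ann := by
    simpa using Ann.sub_mem hu (hle h2)
  refine hw ?_
  have h4 : Φ 1 w = 0 := h3
  rwa [map_one] at h4

end Quotient

end Realization

end

/-! ### Layers of a highest weight module -/

section

section Cofinite

theorem cofg_iff_exists_fg_sup_eq_top {V : Type*} [AddCommGroup V] [Module ℂ V]
    {S : Submodule ℂ V} : S.CoFG ↔ ∃ F : Submodule ℂ V, F.FG ∧ F ⊔ S = ⊤ := by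
  constructor
  · intro h
    obtain ⟨F, hF⟩ := S.exists_isCompl
    exact ⟨F, h.fg_of_isCompl hF, sup_comm F S ▸ hF.sup_eq_top⟩
  · rintro ⟨F, hF, hsup⟩
    refine Module.finite_def.2 ?_
    have h : F.map S.mkQ = ⊤ := by
      have := congrArg (Submodule.map S.mkQ) hsup
      rwa [Submodule.map_sup, Submodule.mkQ_map_self, sup_bot_eq, Submodule.map_top,
        Submodule.range_mkQ] at this
    rw [← h]
    exact hF.map _

variable {A : Type*} [CommRing A] [Algebra ℂ A]

/-- In a finitely generated commutative algebra, the product of two ideals of finite codimension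
has finite codimension. -/
theorem cofg_mul [IsNoetherianRing A] {I J : Ideal A} (hI : (I.restrictScalars ℂ).CoFG)
    (hJ : (J.restrictScalars ℂ).CoFG) : ((I * J).restrictScalars ℂ).CoFG := by
  obtain ⟨F, hF, hFI⟩ := cofg_iff_exists_fg_sup_eq_top.1 hI
  obtain ⟨G, hG, hGJ⟩ := cofg_iff_exists_fg_sup_eq_top.1 hJ
  obtain ⟨s, hs⟩ := IsNoetherian.noetherian I
  have hle : I.restrictScalars ℂ ≤ G * Submodule.span ℂ (s : Set A) ⊔
      (I * J).restrictScalars ℂ := by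
    intro y hy
    rw [Submodule.restrictScalars_mem, ← hs, Submodule.mem_span_finset] at hy
    obtain ⟨f, -, rfl⟩ := hy
    refine Submodule.sum_mem _ fun x hx => ?_
    obtain ⟨g, hg, j, hj, hgj⟩ := Submodule.mem_sup.1 (hGJ.ge (Submodule.mem_top (x := f x)))
    rw [smul_eq_mul, ← hgj, add_mul]
    have hxI : x ∈ I := hs ▸ Submodule.subset_span hx
    exact Submodule.add_mem_sup (Submodule.mul_mem_mul hg (Submodule.subset_span hx))
      (mul_comm x j ▸ Ideal.mul_mem_mul hxI hj)
  refine cofg_iff_exists_fg_sup_eq_top.2 ⟨F ⊔ G * Submodule.span ℂ (s : Set A),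
    hF.sup (hG.mul (Submodule.fg_span s.finite_toSet)), ?_⟩
  rw [sup_assoc, eq_top_iff, ← hFI]
  exact sup_le_sup_left hle F

theorem cofg_inf {I J : Ideal A} (hI : (I.restrictScalars ℂ).CoFG)
    (hJ : (J.restrictScalars ℂ).CoFG) : ((I ⊓ J).restrictScalars ℂ).CoFG := by
  have : (I ⊓ J).restrictScalars ℂ = I.restrictScalars ℂ ⊓ J.restrictScalars ℂ := rfl
  rw [this]
  exact hI.inf hJ

theorem cofg_iInf {κ : Type*} [Finite κ] {J : κ → Ideal A}
    (h : ∀ i, ((J i).restrictScalars ℂ).CoFG) : ((⨅ i, J i).restrictScalars ℂ).CoFG := by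
  have : (⨅ i, J i).restrictScalars ℂ = sInf (Set.range fun i => (J i).restrictScalars ℂ) := by
    ext a
    simp
  rw [this]
  refine Submodule.CoFG.sInf_of_finite (Set.finite_range _) ?_
  rintro _ ⟨i, rfl⟩
  exact h i

end Cofinite

namespace Realization

variable {ι : Type u} [Fintype ι] {C : Matrix ι ι ℤ}
  {𝔥 : Type v} [AddCommGroup 𝔥] [Module ℂ 𝔥] (R : Realization C 𝔥) (hC : IsGCM C)
  {A : Type w} [CommRing A] [Algebra ℂ A] {𝔥'' : Submodule ℂ 𝔥}
  {M : Type*} [AddCommGroup M] [Module ℂ M] (ρ : R.Cur A 𝔥'' →ₗ⁅ℂ⁆ Module.End ℂ M) (v : M)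

theorem map_lie_apply (x y : R.Cur A 𝔥'') (m : M) : ρ ⁅x, y⁆ m = ρ x (ρ y m) - ρ y (ρ x m) := by
  rw [LieHom.map_lie, LieRing.of_associative_ring_bracket]; rfl

theorem apply_apply (x y : R.Cur A 𝔥'') (m : M) : ρ x (ρ y m) = ρ y (ρ x m) + ρ ⁅x, y⁆ m := by
  rw [map_lie_apply]; abel

/-- The action of `f_i ⊗ a` on `m`, as a bilinear map in `a` and `m`. -/
def actF (i : ι) : A →ₗ[ℂ] M →ₗ[ℂ] M :=
  (ρ : R.Cur A 𝔥'' →ₗ[ℂ] Module.End ℂ M) ∘ₗ (R.tensLin A 𝔥'').flip (R.derF hC i)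

/-- The span of the vectors `(f_{i₁} ⊗ a₁) ⋯ (f_{iₖ} ⊗ aₖ) v`. -/
def layer : ℕ → Submodule ℂ M
  | 0 => Submodule.span ℂ {v}
  | k + 1 => ⨆ i, Submodule.map₂ (R.actF hC ρ i) ⊤ (layer k)

theorem actF_mem_layer (i : ι) (a : A) {k : ℕ} {m : M} (hm : m ∈ R.layer hC ρ v k) :
    ρ (R.tens A 𝔥'' a (R.derF hC i)) m ∈ R.layer hC ρ v (k + 1) :=
  Submodule.mem_iSup_of_mem i (Submodule.apply_mem_map₂ _ Submodule.mem_top hm)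

theorem layer_succ_le {k : ℕ} {S : Submodule ℂ M}
    (h : ∀ i a, ∀ m ∈ R.layer hC ρ v k, ρ (R.tens A 𝔥'' a (R.derF hC i)) m ∈ S) :
    R.layer hC ρ v (k + 1) ≤ S :=
  iSup_le fun i => Submodule.map₂_le.2 fun a _ m hm => h i a m hm

theorem adH_derF (h : 𝔥) (i : ι) : R.adH h (R.derF hC i) = -(R.root i h) • R.derF hC i :=
  Subtype.ext ((R.isChevalley.hf h i).trans (neg_smul _ _).symm)

theorem tens_smul (a : A) (c : ℂ) (x : R.derived) :
    R.tens A 𝔥'' a (c • x) = c • R.tens A 𝔥'' a x := by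
  rw [← tensLin_apply, ← tensLin_apply, map_smul]

theorem curH_mem_layer (hv : ∀ h, ∃ c : ℂ, ρ (R.curH A 𝔥'' h) v = c • v) (h : R.CurH A 𝔥'')
    (k : ℕ) {m : M} (hm : m ∈ R.layer hC ρ v k) :
    ρ (R.curH A 𝔥'' h) m ∈ R.layer hC ρ v k := by
  induction k generalizing m h with
  | zero =>
    obtain ⟨c, rfl⟩ := Submodule.mem_span_singleton.1 hm
    obtain ⟨d, hd⟩ := hv h
    rw [map_smul, hd]
    exact Submodule.smul_mem _ _ (Submodule.smul_mem _ _ (Submodule.mem_span_singleton_self v))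
  | succ k ih =>
    have hle (h : R.CurH A 𝔥'') (hf : ∀ i b, ∃ c b', ⁅R.curH A 𝔥'' h,
        R.tens A 𝔥'' b (R.derF hC i)⁆ = (c : ℂ) • R.tens A 𝔥'' b' (R.derF hC i)) :
        ρ (R.curH A 𝔥'' h) m ∈ R.layer hC ρ v (k + 1) := by
      refine R.layer_succ_le hC ρ v
        (S := (R.layer hC ρ v (k + 1)).comap (ρ (R.curH A 𝔥'' h))) (fun i a m hm => ?_) hm
      obtain ⟨c, b', hcb⟩ := hf i a
      rw [Submodule.mem_comap, apply_apply, hcb, map_smul]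
      exact add_mem (R.actF_mem_layer hC ρ v i a (ih h hm))
        (Submodule.smul_mem _ _ (R.actF_mem_layer hC ρ v i b' hm))
    have := R.curH_eq_top A 𝔥'' (S := (R.layer hC ρ v (k + 1)).comap
      ((ρ : R.Cur A 𝔥'' →ₗ[ℂ] Module.End ℂ M).flip m ∘ₗ R.curH A 𝔥''))
      (fun a x => hle _ fun i b => ⟨-(R.root i x), a * b, by
        rw [curH_tmul, tens_lie_tens, cartanIncl_lie, adH_derF, tens_smul]⟩)
      (fun y => hle _ fun i b => ⟨-(R.root i y), b, by
        rw [curH_lie_tens_of_right, adH_derF, tens_smul]⟩)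
    exact this.ge (Submodule.mem_top (x := h))

/-- A module generated by a highest weight vector `v` is spanned by the vectors
`(f_{i₁} ⊗ a₁) ⋯ (f_{iₖ} ⊗ aₖ) v`. -/
theorem iSup_layer_eq_top (hv : ∀ h, ∃ c : ℂ, ρ (R.curH A 𝔥'' h) v = c • v)
    (hvE : ∀ a i, ρ (R.tens A 𝔥'' a (R.derE hC i)) v = 0)
    (hgen : ∀ S : Submodule ℂ M, v ∈ S → (∀ x, ∀ m ∈ S, ρ x m ∈ S) → S = ⊤) :
    ⨆ k, R.layer hC ρ v k = ⊤ := by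
  classical
  set S := ⨆ k, R.layer hC ρ v k with hS
  have hlie {x y : R.Cur A 𝔥''} (hx : ∀ m ∈ S, ρ x m ∈ S) (hy : ∀ m ∈ S, ρ y m ∈ S) :
      ∀ m ∈ S, ρ ⁅x, y⁆ m ∈ S := fun m hm => by
    rw [map_lie_apply]; exact sub_mem (hx _ (hy m hm)) (hy _ (hx m hm))
  have ofLayer {x : R.Cur A 𝔥''} (h : ∀ k, ∀ m ∈ R.layer hC ρ v k, ρ x m ∈ S) :
      ∀ m ∈ S, ρ x m ∈ S := fun m hm =>
    (iSup_le (a := S.comap (ρ x)) fun k m hm => h k m hm) hm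
  have hF (i : ι) (a : A) : ∀ m ∈ S, ρ (R.tens A 𝔥'' a (R.derF hC i)) m ∈ S :=
    ofLayer fun k m hm => Submodule.mem_iSup_of_mem (k + 1) (R.actF_mem_layer hC ρ v i a hm)
  have hH (h : R.CurH A 𝔥'') : ∀ m ∈ S, ρ (R.curH A 𝔥'' h) m ∈ S :=
    ofLayer fun k m hm => Submodule.mem_iSup_of_mem k (R.curH_mem_layer hC ρ v hv h k hm)
  have hE (j : ι) (a : A) : ∀ m ∈ S, ρ (R.tens A 𝔥'' a (R.derE hC j)) m ∈ S := by
    refine ofLayer fun k => ?_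
    induction k with
    | zero =>
      intro m hm
      obtain ⟨c, rfl⟩ := Submodule.mem_span_singleton.1 hm
      rw [map_smul, hvE, smul_zero]
      exact zero_mem _
    | succ k ih =>
      refine fun m hm => R.layer_succ_le hC ρ v (S := S.comap (ρ (R.tens A 𝔥'' a (R.derE hC j))))
        (fun i b m hm => ?_) hm
      rw [Submodule.mem_comap, apply_apply]
      refine add_mem (hF i b _ (ih m hm)) ?_
      rw [tens_lie_tens, derE_lie_derF]
      split_ifs
      · rw [← curH_tmul]; exact hH _ m (Submodule.mem_iSup_of_mem k hm)
      · rw [← tensLin_apply, map_zero, map_zero]; exact zero_mem _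
  have word {e : ι → R.derived} (he : ∀ i a, ∀ m ∈ S, ρ (R.tens A 𝔥'' a (e i)) m ∈ S)
      {x : R.derived} (hx : IsWord e x) (a : A) : ∀ m ∈ S, ρ (R.tens A 𝔥'' a x) m ∈ S := by
    induction hx generalizing a with
    | base i => exact he i a
    | step i _ ih =>
      rw [← one_mul a, ← tens_lie_tens]
      exact hlie (he i 1) (ih a)
  refine hgen S (Submodule.mem_iSup_of_mem 0 (Submodule.mem_span_singleton_self v))
    fun x m hm => ?_
  have := R.cur_eq_top A 𝔥'' hC (S := S.comap
      ((ρ : R.Cur A 𝔥'' →ₗ[ℂ] Module.End ℂ M).flip m))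
    (fun a x hx => word hF hx a m hm) (by rintro _ ⟨h, rfl⟩; exact hH h m hm)
    (fun a x hx => word hE hx a m hm)
  exact this.ge (Submodule.mem_top (x := x))

/-- If for each `i` the `f_i ⊗ a` kill `v` for all `a` in an ideal of finite codimension, then on
each layer the `X ⊗ a` vanish for all `a` in an ideal of finite codimension, for every bracket
`X` of the `f_i`. -/
theorem exists_cofg_ideal_layer [IsNoetherianRing A] (hvF : ∀ i, ∃ J : Ideal A,
      (J.restrictScalars ℂ).CoFG ∧ ∀ a ∈ J, ρ (R.tens A 𝔥'' a (R.derF hC i)) v = 0)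
    (k : ℕ) {x : R.derived} (hx : IsWord (R.derF hC) x) : ∃ J : Ideal A,
      (J.restrictScalars ℂ).CoFG ∧
        ∀ a ∈ J, ∀ m ∈ R.layer hC ρ v k, ρ (R.tens A 𝔥'' a x) m = 0 := by
  induction k generalizing x with
  | zero =>
    suffices h : ∃ J : Ideal A, (J.restrictScalars ℂ).CoFG ∧
        ∀ a ∈ J, ρ (R.tens A 𝔥'' a x) v = 0 by
      obtain ⟨J, hJ, h⟩ := h
      refine ⟨J, hJ, fun a ha m hm => ?_⟩
      obtain ⟨c, rfl⟩ := Submodule.mem_span_singleton.1 hm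
      rw [map_smul, h a ha, smul_zero]
    induction hx with
    | base i => exact hvF i
    | @step i x _ ih =>
      obtain ⟨I, hI, h1⟩ := hvF i
      obtain ⟨J, hJ, h2⟩ := ih
      refine ⟨I * J, cofg_mul hI hJ, fun a ha => ?_⟩
      induction ha using Submodule.mul_induction_on' with
      | mem_mul_mem a ha b hb =>
        rw [← tens_lie_tens, map_lie_apply, h1 a ha, h2 b hb, map_zero, map_zero, sub_zero]
      | add a _ b _ ha hb =>
        rw [← tensLin_apply, map_add, LinearMap.add_apply, map_add, LinearMap.add_apply,
          tensLin_apply, tensLin_apply, ha, hb, add_zero]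
  | succ k ih =>
    obtain ⟨J, hJ, h1⟩ := ih hx
    choose J' hJ' h2 using fun i => ih (IsWord.step i hx)
    refine ⟨J ⊓ ⨅ i, J' i, cofg_inf hJ (cofg_iInf hJ'), fun a ha m hm => ?_⟩
    have := R.layer_succ_le hC ρ v (S := LinearMap.ker (ρ (R.tens A 𝔥'' a x)))
      (fun i b m hm => by
        have h3 := h2 i (b * a) (Ideal.mul_mem_left _ b (Ideal.mem_iInf.1 ha.2 i)) m hm
        rw [LinearMap.mem_ker, apply_apply, h1 a ha.1 m hm, map_zero, zero_add, ← lie_skew,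
          tens_lie_tens, map_neg, LinearMap.neg_apply, h3, neg_zero])
    exact this hm

/-- Under the assumptions of `exists_cofg_ideal_layer` the layers are finite-dimensional. -/
theorem layer_fg [IsNoetherianRing A] (hvF : ∀ i, ∃ J : Ideal A,
      (J.restrictScalars ℂ).CoFG ∧ ∀ a ∈ J, ρ (R.tens A 𝔥'' a (R.derF hC i)) v = 0)
    (k : ℕ) : (R.layer hC ρ v k).FG := by
  induction k with
  | zero => exact Submodule.fg_span_singleton v
  | succ k ih =>
    refine Submodule.fg_iSup _ fun i => ?_
    obtain ⟨J, hJ, h⟩ := R.exists_cofg_ideal_layer hC ρ v hvF k (IsWord.base i)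
    obtain ⟨F, hF, hFJ⟩ := cofg_iff_exists_fg_sup_eq_top.1 hJ
    have : Submodule.map₂ (R.actF hC ρ i) (J.restrictScalars ℂ) (R.layer hC ρ v k) = ⊥ :=
      eq_bot_iff.2 (Submodule.map₂_le.2 fun a ha m hm => h a ha m hm)
    rw [← hFJ, Submodule.map₂_sup_left, this, sup_bot_eq]
    exact hF.map₂ _ ih

/-- The weight space of weight `μ` for `𝔥`. -/
def actWeightSpace (μ : Module.Dual ℂ 𝔥) : Submodule ℂ M :=
  ⨅ (x : R.cartanDerived) (y : 𝔥''),
    (ρ (R.curH A 𝔥'' (R.hEmb A 𝔥'' x y))).eigenspace (μ ((x : 𝔥) + y))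

theorem mem_actWeightSpace {μ : Module.Dual ℂ 𝔥} {m : M} : m ∈ R.actWeightSpace ρ μ ↔
    ∀ (x : R.cartanDerived) (y : 𝔥''),
      ρ (R.curH A 𝔥'' (R.hEmb A 𝔥'' x y)) m = μ ((x : 𝔥) + y) • m := by
  simp only [actWeightSpace, Submodule.mem_iInf, Module.End.mem_eigenspace_iff]

/-- The vectors `(f_{i₁} ⊗ a₁) ⋯ (f_{iₖ} ⊗ aₖ) v` are weight vectors, of weight
`λ - α_{i₁} - ⋯ - α_{iₖ}`. -/
theorem layer_le_iSup_actWeightSpace {h₀ : 𝔥} (h1 : ∀ i, R.root i h₀ = 1)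
    {lam : Module.Dual ℂ 𝔥} (hv : v ∈ R.actWeightSpace ρ lam) (k : ℕ) :
    R.layer hC ρ v k ≤ ⨆ (μ : Module.Dual ℂ 𝔥) (_ : μ h₀ = lam h₀ - k),
      R.actWeightSpace ρ μ := by
  induction k with
  | zero =>
    refine (Submodule.span_singleton_le_iff_mem _ _).2 ?_
    exact Submodule.mem_iSup_of_mem lam (Submodule.mem_iSup_of_mem (by simp) hv)
  | succ k ih =>
    refine R.layer_succ_le hC ρ v fun i a m hm => ?_
    have hle : (⨆ (μ : Module.Dual ℂ 𝔥) (_ : μ h₀ = lam h₀ - k), R.actWeightSpace ρ μ) ≤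
        (⨆ (μ : Module.Dual ℂ 𝔥) (_ : μ h₀ = lam h₀ - (k + 1 : ℕ)),
          R.actWeightSpace ρ μ).comap (ρ (R.tens A 𝔥'' a (R.derF hC i))) := by
      refine iSup₂_le fun μ hμ m hm => ?_
      refine Submodule.mem_iSup_of_mem (μ - R.root i) (Submodule.mem_iSup_of_mem ?_ ?_)
      · rw [LinearMap.sub_apply, hμ, h1]; push_cast; ring
      · rw [mem_actWeightSpace] at hm ⊢
        intro x y
        rw [apply_apply, hm, curH_hEmb_lie_tens, adH_derF, tens_smul, map_smul, map_smul,
          LinearMap.smul_apply, ← add_smul, LinearMap.sub_apply, sub_eq_add_neg]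
    exact hle (ih hm)

/-- In a module that is the sum of its layers, the sum of the weight spaces is everything; if the
layers are finite-dimensional, then each weight space, being contained in a layer, is
finite-dimensional. -/
theorem weights_of_layers (h_compl : IsCompl R.cartanDerived 𝔥'')
    {lam : Module.Dual ℂ 𝔥} (hv : v ∈ R.actWeightSpace ρ lam)
    (htop : ⨆ k, R.layer hC ρ v k = ⊤) (hfg : ∀ k, (R.layer hC ρ v k).FG) :
    (∀ μ, FiniteDimensional ℂ (R.actWeightSpace ρ μ)) ∧ ⨆ μ, R.actWeightSpace ρ μ = ⊤ := by
  obtain ⟨h₀, h1⟩ := R.exists_root_eq_one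
  constructor
  · intro μ
    obtain ⟨x₀, hx₀, y₀, hy₀, h₀eq⟩ := Submodule.mem_sup.1
      (h_compl.sup_eq_top.ge (Submodule.mem_top (x := h₀)))
    set D := ρ (R.curH A 𝔥'' (R.hEmb A 𝔥'' ⟨x₀, hx₀⟩ ⟨y₀, hy₀⟩)) with hD
    have hwt (ν : Module.Dual ℂ 𝔥) : R.actWeightSpace ρ ν ≤ D.eigenspace (ν h₀) := by
      intro m hm
      rw [Module.End.mem_eigenspace_iff, ← h₀eq]
      exact (R.mem_actWeightSpace ρ).1 hm ⟨x₀, hx₀⟩ ⟨y₀, hy₀⟩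
    have hlay (k : ℕ) : R.layer hC ρ v k ≤ D.eigenspace (lam h₀ - k) :=
      (R.layer_le_iSup_actWeightSpace hC ρ v h1 hv k).trans
        (iSup₂_le fun ν hν => hν ▸ hwt ν)
    have hfin : ∃ S : Submodule ℂ M, S.FG ∧ D.eigenspace (μ h₀) ≤ S := by
      by_cases h : ∃ k : ℕ, μ h₀ = lam h₀ - k
      · obtain ⟨k, hk⟩ := h
        refine ⟨_, hfg k, hk ▸ eigenspace_le_of_le_sup D _ _ (hlay k) ?_⟩
        rw [← htop]
        refine iSup_le fun j => ?_
        by_cases hj : j = k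
        · subst hj; exact le_sup_left
        · refine le_sup_of_le_right (le_iSup₂_of_le _ ?_ (hlay j))
          intro h; apply hj; exact_mod_cast sub_right_injective h
      · refine ⟨⊥, Submodule.fg_bot, eigenspace_le_of_le_sup D _ _ bot_le ?_⟩
        rw [← htop]
        refine iSup_le fun j => le_sup_of_le_right (le_iSup₂_of_le _ ?_ (hlay j))
        exact fun h' => h ⟨j, h'.symm⟩
    obtain ⟨S, hS, hle⟩ := hfin
    have : FiniteDimensional ℂ S := Module.Finite.iff_fg.2 hS
    exact Submodule.finiteDimensional_of_le ((hwt μ).trans hle)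
  · rw [eq_top_iff, ← htop]
    refine iSup_le fun k => (R.layer_le_iSup_actWeightSpace hC ρ v h1 hv k).trans ?_
    exact iSup₂_le fun μ _ => le_iSup _ μ

end Realization

end

/-! ### Weight spaces of highest weight modules -/

section

namespace Realization

variable {ι : Type u} [Fintype ι] {C : Matrix ι ι ℤ}
  {𝔥 : Type v} [AddCommGroup 𝔥] [Module ℂ 𝔥] (R : Realization C 𝔥)

theorem genE_mem_rootSpace (i : ι) : R.genE i ∈ R.rootSpace (R.root i) :=
  fun h => R.isChevalley.he h i

theorem genF_mem_rootSpace (i : ι) : R.genF i ∈ R.rootSpace (-(R.root i)) :=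
  fun h => (R.isChevalley.hf h i).trans (neg_smul _ _).symm

/-- The simple roots are positive roots; `e_i ≠ 0` because `[e_i, f_i] = α_i^∨ ≠ 0`. -/
theorem root_mem_posRoots (i : ι) : R.root i ∈ R.posRoots := by
  refine ⟨AddSubmonoid.subset_closure ⟨i, rfl⟩, R.linearIndependent_root.ne_zero i, ?_⟩
  intro h
  have he : R.genE i = 0 := (Submodule.mem_bot ℂ).1 (h ▸ R.genE_mem_rootSpace i)
  refine R.linearIndependent_coroot.ne_zero i (R.ofH_injective ?_)
  rw [← R.isChevalley.ef, he, zero_lie, map_zero]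

variable {A : Type w} [CommRing A] [Algebra ℂ A] {𝔥'' : Submodule ℂ 𝔥}

section Rep

variable {M : Type*} [AddCommGroup M] [Module ℂ M] [Module (R.U A 𝔥'') M]
  [IsScalarTower ℂ (R.U A 𝔥'') M]

variable (A 𝔥'' M) in
/-- The action of `𝔤' ⊗ A ⊕ 𝔥''` on a module over its enveloping algebra. -/
def actionOf : R.Cur A 𝔥'' →ₗ⁅ℂ⁆ Module.End ℂ M :=
  ((Algebra.lsmul ℂ ℂ M : R.U A 𝔥'' →ₐ[ℂ] Module.End ℂ M) :
    R.U A 𝔥'' →ₗ⁅ℂ⁆ Module.End ℂ M).comp (UniversalEnvelopingAlgebra.ι ℂ)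

theorem weightSpace_eq (μ : Module.Dual ℂ 𝔥) :
    R.weightSpace A 𝔥'' M μ = R.actWeightSpace (R.actionOf A 𝔥'' M) μ := by
  ext m
  rw [mem_actWeightSpace]
  rfl

/-- A subspace stable under `𝔤' ⊗ A ⊕ 𝔥''` that contains a generator is everything. -/
theorem eq_top_of_actionOf_mem {v : M} (hv : Submodule.span (R.U A 𝔥'') {v} = ⊤)
    (S : Submodule ℂ M) (h1 : v ∈ S) (h2 : ∀ x, ∀ m ∈ S, R.actionOf A 𝔥'' M x m ∈ S) :
    S = ⊤ := by
  refine eq_top_iff.2 fun m _ => ?_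
  obtain ⟨u, rfl⟩ := Submodule.mem_span_singleton.1 (hv.ge (Submodule.mem_top (x := m)))
  have := universalEnveloping_eq_top_of_mul_mem
    (S.comap ((Algebra.lsmul ℂ ℂ M : R.U A 𝔥'' →ₐ[ℂ] Module.End ℂ M).toLinearMap.flip v))
    (by
      change (1 : R.U A 𝔥'') • v ∈ S
      rwa [one_smul])
    (fun y u hu => by
      change (UniversalEnvelopingAlgebra.ι ℂ y * u) • v ∈ S
      rw [mul_smul]
      exact h2 y _ hu)
  exact this.ge (Submodule.mem_top (x := u))

/-- A highest weight module, in which the highest weight vector is killed by the `f_i ⊗ a` for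
`a` in ideals of finite codimension, is the sum of its weight spaces, which are
finite-dimensional. -/
theorem IsHighestWeight.weights (hC : IsGCM C) [Algebra.FiniteType ℂ A]
    (h_compl : IsCompl R.cartanDerived 𝔥'') {ψ : Module.Dual ℂ (R.CurH A 𝔥'')}
    {lam : Module.Dual ℂ 𝔥} (hψ_lam : ∀ (x : R.cartanDerived) (y : 𝔥''),
      ψ (R.hEmb A 𝔥'' x y) = lam ((x : 𝔥) + (y : 𝔥)))
    {v : M} (hv : R.IsHighestWeight ψ v) (J : ι → Ideal A)
    (hJ : ∀ i, Module.Finite ℂ (A ⧸ J i))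
    (hvF : ∀ i, ∀ a ∈ J i, R.uTensor A 𝔥'' a (R.derF hC i) • v = 0) :
    (∀ μ : Module.Dual ℂ 𝔥, FiniteDimensional ℂ (R.weightSpace A 𝔥'' M μ)) ∧
      (⨆ μ : Module.Dual ℂ 𝔥, R.weightSpace A 𝔥'' M μ) = ⊤ := by
  have : IsNoetherianRing A := Algebra.FiniteType.isNoetherianRing ℂ A
  have hwt : R.weightSpace A 𝔥'' M = R.actWeightSpace (R.actionOf A 𝔥'' M) :=
    funext R.weightSpace_eq
  rw [hwt]
  refine R.weights_of_layers hC (R.actionOf A 𝔥'' M) v h_compl (lam := lam) ?_ ?_ ?_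
  · rw [mem_actWeightSpace]
    intro x y
    rw [← hψ_lam]
    exact hv.cartan (R.hEmb A 𝔥'' x y)
  · exact R.iSup_layer_eq_top hC _ v (fun h => ⟨ψ h, hv.cartan h⟩)
      (fun a i => hv.nPlus _ (R.root_mem_posRoots i) _ (R.genE_mem_rootSpace i) a)
      (R.eq_top_of_actionOf_mem hv.generates)
  · exact R.layer_fg hC _ v fun i => ⟨J i, hJ i, hvF i⟩

end Rep

section Quotient

variable (ψ : Module.Dual ℂ (R.CurH A 𝔥'')) (I : R.posRoots → Ideal A)

theorem smul_vermaVec (u : R.U A 𝔥'') :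
    u • R.vermaVec ψ = Submodule.Quotient.mk (p := R.vermaIdeal ψ) u := by
  rw [vermaVec, ← Submodule.Quotient.mk_smul, smul_eq_mul, mul_one]

theorem smul_mVec (u : R.U A 𝔥'') :
    u • R.mVec ψ I = Submodule.Quotient.mk (p := R.relSubmodule ψ I) (u • R.vermaVec ψ) := rfl

theorem smul_mVec_eq_zero_of_mem {u : R.U A 𝔥''} (hu : u ∈ R.vermaIdeal ψ) :
    u • R.mVec ψ I = 0 := by
  rw [smul_mVec, smul_vermaVec, (Submodule.Quotient.mk_eq_zero _).2 hu]
  rfl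

theorem isHighestWeight_mVec (h : R.vermaVec ψ ∉ R.relSubmodule ψ I) :
    R.IsHighestWeight ψ (R.mVec ψ I) where
  ne_zero h0 := h ((Submodule.Quotient.mk_eq_zero _).1 h0)
  nPlus β hβ x hx a := R.smul_mVec_eq_zero_of_mem ψ I
    (Submodule.subset_span (.inl ⟨β, hβ, x, hx, a, rfl⟩))
  cartan h := by
    have := R.smul_mVec_eq_zero_of_mem ψ I (Submodule.subset_span (.inr ⟨h, rfl⟩))
    rwa [sub_smul, algebraMap_smul, sub_eq_zero] at this
  generates := by
    refine eq_top_iff.2 fun m _ => ?_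
    obtain ⟨m, rfl⟩ := Submodule.Quotient.mk_surjective _ m
    obtain ⟨u, rfl⟩ := Submodule.Quotient.mk_surjective _ m
    refine Submodule.mem_span_singleton.2 ⟨u, ?_⟩
    rw [smul_mVec, smul_vermaVec]

theorem uTensor_smul_mVec (β : R.posRoots) (x : R.derived)
    (hx : (x : R.Alg) ∈ R.rootSpace (-(β : Module.Dual ℂ 𝔥))) (a : A) (ha : a ∈ I β) :
    R.uTensor A 𝔥'' a x • R.mVec ψ I = 0 :=
  (Submodule.Quotient.mk_eq_zero _).2 (Submodule.subset_span ⟨β, x, hx, a, ha, rfl⟩)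

end Quotient

end Realization

end

end KacMoody

end

theorem mainTheorem4
    {ι : Type*} [Fintype ι] {C : Matrix ι ι ℤ} (hC : KacMoody.IsGCM C)
    {𝔥 : Type*} [AddCommGroup 𝔥] [Module ℂ 𝔥] (R : KacMoody.Realization C 𝔥)
    (𝔥'' : Submodule ℂ 𝔥) (h_compl : IsCompl R.cartanDerived 𝔥'')
    {A : Type*} [CommRing A] [Algebra ℂ A] [Algebra.FiniteType ℂ A]
    (I : Ideal A) (hI : Module.Finite ℂ (A ⧸ I))
    (Iβ : R.posRoots → Ideal A) (hIβ : ∀ β, Module.Finite ℂ (A ⧸ Iβ β))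
    (hIβ_le : ∀ β, Iβ β ≤ I)
    (h_anti : ∀ α β : R.posRoots,
      (β : Module.Dual ℂ 𝔥) - (α : Module.Dual ℂ 𝔥) ∈ R.posCone → Iβ β ≤ Iβ α)
    (h_mul : ∀ α β γ : R.posRoots,
      (α : Module.Dual ℂ 𝔥) + (β : Module.Dual ℂ 𝔥) = (γ : Module.Dual ℂ 𝔥) →
        Iβ α * Iβ β ≤ Iβ γ)
    (ψ : Module.Dual ℂ (R.CurH A 𝔥''))
    (hψI : ∀ a ∈ I, ∀ x : R.cartanDerived, ψ (a ⊗ₜ[ℂ] x, 0) = 0)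
    (lam : Module.Dual ℂ 𝔥)
    (hψ_lam : ∀ (x : R.cartanDerived) (y : 𝔥''),
      ψ (R.hEmb A 𝔥'' x y) = lam ((x : 𝔥) + (y : 𝔥)))
    (h_dom : ∀ i, ∃ n : ℕ, lam (R.coroot i) = (n : ℂ)) :
    R.relSubmodule ψ Iβ ≠ ⊤ ∧
      R.IsHighestWeight ψ (R.mVec ψ Iβ) ∧
      (∀ (β : R.posRoots) (x : R.derived),
        (x : R.Alg) ∈ R.rootSpace (-(β : Module.Dual ℂ 𝔥)) → ∀ a ∈ Iβ β,
          R.uTensor A 𝔥'' a x • R.mVec ψ Iβ = 0) ∧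
      (∀ μ : Module.Dual ℂ 𝔥, FiniteDimensional ℂ (R.weightSpace A 𝔥'' (R.MMod ψ Iβ) μ)) ∧
      (⨆ μ : Module.Dual ℂ 𝔥, R.weightSpace A 𝔥'' (R.MMod ψ Iβ) μ) = ⊤ := by

  have hv := R.vermaVec_notMem_relSubmodule 𝔥'' hC h_compl I Iβ hIβ_le ψ hψI
  have hM := R.isHighestWeight_mVec ψ Iβ hv
  refine ⟨fun h => hv (h ▸ Submodule.mem_top), hM, R.uTensor_smul_mVec ψ Iβ, ?_⟩
  exact hM.weights R hC h_compl hψ_lam (fun i => Iβ ⟨R.root i, R.root_mem_posRoots i⟩)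
    (fun i => hIβ _) fun i a ha => R.uTensor_smul_mVec ψ Iβ ⟨R.root i, R.root_mem_posRoots i⟩
      (R.derF hC i) (R.genF_mem_rootSpace i) a ha
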